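/- Let $M_n$ be the complex $n\times n$ matrices with the Hilbert--Schmidt norm $\|x\|=(\mathrm{Tr}\,x^*x)^{1/2}$, let $\mathcal M\subset M_n$ be the set of positive definite matrices and $\mathcal D=\{\rho\in\mathcal M:\mathrm{Tr}\,\rho=1\}$. For $\alpha\in[-3,3]$ the Wigner--Yanase--Dyson (WYD) metric $\lambda^\alpha$ on $\mathcal M$ is $$\lambda^\alpha_\rho(h,k)=\frac{\partial^2}{\partial t\,\partial s}\mathrm{Tr}\,f_\alpha(\rho+th)f_{-\alpha}(\rho+sk)\Big|_{s=t=0},\qquad h=h^*,\ k=k^*,$$ where $f_\alpha(x)=\frac{2}{1-\alpha}x^{\frac{1-\alpha}{2}}$ for $\alpha\neq1$ and $f_1(x)=\log x$; $\lambda^0$ is the Wigner--Yanase (WY) metric. For such a metric $\lambda$ let $d_\lambda(\rho_0,\rho_1)$ (resp. $D_\lambda(\rho_0,\rho_1)$) be the infimum of the lengths $\int_0^1\sqrt{\lambda_{\rho_t}(\dot\rho_t,\dot\rho_t)}\,dt$ of the smooth curves $(\rho_t)_{t\in[0,1]}$ in $\mathcal M$ (resp. $\mathcal D$) from $\rho_0$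 to $\rho_1$; a curve whose length is the minimum is called a geodesic path. Write $d_{WY},D_{WY}$ for $\lambda=\lambda^0$. Put $g_0(t)=2+2t-4t^{1/2}$, and $$S_g(\rho,\sigma)=\mathrm{Tr}\,\rho^{1/2}g(\Delta_{\sigma,\rho})(\rho^{1/2}),\quad \Delta_{\sigma,\rho}(x)=\sigma x\rho^{-1},\qquad H_g(\rho_0,\rho_1)=\mathrm{Tr}\,\rho_0\,g(\rho_0^{-1/2}\rho_1\rho_0^{-1/2}),$$ $$\rho_0\#\rho_1=\rho_0^{1/2}(\rho_0^{-1/2}\rho_1\rho_0^{-1/2})^{1/2}\rho_0^{1/2}.$$ (1) For all $\rho_0,\rho_1\in\mathcal M$ and every WYD metric $\lambda=\lambda^\alpha$, $\alpha\in[-3,3]$, $$\sqrt{2S_{g_0}(\rho_0,\rho_1)}=d_{WY}(\rho_0,\rho_1)=2\|\rho_0^{1/2}-\rho_1^{1/2}\|\le d_\lambda(\rho_0,\rho_1)\le\sqrt{2H_{g_0}(\rho_0,\rho_1)},$$ and $\rho_t=(t\rho_1^{1/2}+(1-t)\rho_0^{1/2})^2$ is a geodesic path in $\mathcal M$ for the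 WY metric. (2) For all $\rho_0,\rho_1\in\mathcal D$ and every WYD metric $\lambda=\lambda^\alpha$, $\alpha\in[-3,3]$, $$2\arccos\mathrm{Tr}\,\rho_0^{1/2}\rho_1^{1/2}=D_{WY}(\rho_0,\rho_1)\le D_\lambda(\rho_0,\rho_1)\le2\arccos\mathrm{Tr}\,\rho_0\#\rho_1,$$ and $\rho_t=(t\rho_1^{1/2}+(1-t)\rho_0^{1/2})^2/\|t\rho_1^{1/2}+(1-t)\rho_0^{1/2}\|^2$ is a geodesic path in $\mathcal D$ for the WY metric. -/

import Mathlib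

open Set MeasureTheory
open scoped ENNReal ContDiff ComplexOrder Matrix Matrix.Norms.Frobenius

noncomputable section

/-- `M_n`, the algebra of complex `n × n` matrices; its norm is the Hilbert–Schmidt (Frobenius) norm,
`‖x‖ = (Tr x* x)^{1/2}`. -/
abbrev CMat (n : ℕ) : Type := Matrix (Fin n) (Fin n) ℂ

/-- The cone of positive definite matrices. -/
def posDefs (n : ℕ) : Set (CMat n) := {ρ | ρ.PosDef}

/-- The (strictly positive) density matrices: positive definite matrices of trace one. -/
def densities (n : ℕ) : Set (CMat n) := {ρ | ρ.PosDef ∧ ρ.trace = 1}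

/-- The square root of a positive definite matrix, by functional calculus. -/
def msqrt {n : ℕ} (ρ : CMat n) : CMat n := cfc Real.sqrt ρ

/-- The geometric mean `ρ₀ # ρ₁ = ρ₀^{1/2} (ρ₀^{-1/2} ρ₁ ρ₀^{-1/2})^{1/2} ρ₀^{1/2}`. -/
def geomMean {n : ℕ} (ρ₀ ρ₁ : CMat n) : CMat n :=
  msqrt ρ₀ * msqrt ((msqrt ρ₀)⁻¹ * ρ₁ * (msqrt ρ₀)⁻¹) * msqrt ρ₀

/-! ### Riemannian length and geodesic distance

A metric is given by a family of forms `lam ρ h k`; only its values at positive definite `ρ` and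
Hermitian `h`, `k` matter. -/

/-- `γ` is a smooth curve in `S`, defined on `[0,1]`, connecting `ρ₀` to `ρ₁`. -/
structure IsCurve {n : ℕ} (S : Set (CMat n)) (ρ₀ ρ₁ : CMat n) (γ : ℝ → CMat n) : Prop where
  smooth : ContDiffOn ℝ ∞ γ (Icc 0 1)
  mapsTo : MapsTo γ (Icc 0 1) S
  source : γ 0 = ρ₀
  target : γ 1 = ρ₁

/-- The length `∫₀¹ (λ_{γ t}(γ' t, γ' t))^{1/2} dt` of a curve. -/
def curveLength {n : ℕ} (lam : CMat n → CMat n → CMat n → ℝ) (γ : ℝ → CMat n) : ℝ≥0∞ :=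
  ∫⁻ t in Icc (0 : ℝ) 1, ENNReal.ofReal
    (Real.sqrt (lam (γ t) (derivWithin γ (Icc 0 1) t) (derivWithin γ (Icc 0 1) t)))

/-- The geodesic distance of `ρ₀` and `ρ₁` in `S`: the infimum of the lengths of the smooth curves
in `S` that connect them. -/
def geodesicDist {n : ℕ} (lam : CMat n → CMat n → CMat n → ℝ) (S : Set (CMat n))
    (ρ₀ ρ₁ : CMat n) : ℝ≥0∞ :=
  ⨅ (γ : ℝ → CMat n) (_ : IsCurve S ρ₀ ρ₁ γ), curveLength lam γ

/-- A geodesic path in `S` from `ρ₀` to `ρ₁`: a smooth curve whose length is the minimum of the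
lengths of all smooth curves in `S` connecting `ρ₀` and `ρ₁`. -/
def IsGeodesicPath {n : ℕ} (lam : CMat n → CMat n → CMat n → ℝ) (S : Set (CMat n))
    (ρ₀ ρ₁ : CMat n) (γ : ℝ → CMat n) : Prop :=
  IsCurve S ρ₀ ρ₁ γ ∧ ∀ η : ℝ → CMat n, IsCurve S ρ₀ ρ₁ η → curveLength lam γ ≤ curveLength lam η

/-! ### The Wigner–Yanase–Dyson metrics -/

/-- `f_α(x) = 2/(1-α) x^{(1-α)/2}` for `α ≠ 1`, and `f_1(x) = log x`. -/
def wydFun (α : ℝ) (x : ℝ) : ℝ :=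
  if α = 1 then Real.log x else 2 / (1 - α) * x ^ ((1 - α) / 2)

/-- `λ^α_ρ(h,k) = ∂²/∂t∂s Tr f_α(ρ + t h) f_{-α}(ρ + s k)` at `t = s = 0`
(the trace of a product of two Hermitian matrices is real). -/
def wydMetric (n : ℕ) (α : ℝ) (ρ h k : CMat n) : ℝ :=
  deriv (fun t : ℝ => deriv (fun s : ℝ =>
    (cfc (wydFun α) (ρ + t • h) * cfc (wydFun (-α)) (ρ + s • k)).trace.re) 0) 0

/-- The Wigner–Yanase metric, the case `α = 0`. -/
def wyMetric (n : ℕ) : CMat n → CMat n → CMat n → ℝ := wydMetric n 0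

/-! ### Relative entropies -/

/-- `g₀(t) = 2 + 2t - 4 t^{1/2}`. -/
def gZero (t : ℝ) : ℝ := 2 + 2 * t - 4 * Real.sqrt t

/-- The relative modular operator `Δ_{σ,ρ} = L_σ R_ρ⁻¹`, that is `x ↦ σ x ρ⁻¹`. -/
def relModular {n : ℕ} (σ ρ : CMat n) : CMat n →ₗ[ℂ] CMat n :=
  LinearMap.mulLeft ℂ σ ∘ₗ LinearMap.mulRight ℂ ρ⁻¹

/-- Functional calculus of an operator `T` on `M_n` that is self-adjoint for `⟨x, y⟩ = Tr x* y`,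
through the matrix of `T` in the basis of matrix units, which is orthonormal. -/
def superCfc {n : ℕ} (g : ℝ → ℝ) (T : CMat n →ₗ[ℂ] CMat n) : CMat n →ₗ[ℂ] CMat n :=
  Matrix.toLin (Matrix.stdBasis ℂ (Fin n) (Fin n)) (Matrix.stdBasis ℂ (Fin n) (Fin n))
    (cfc g (LinearMap.toMatrix (Matrix.stdBasis ℂ (Fin n) (Fin n))
      (Matrix.stdBasis ℂ (Fin n) (Fin n)) T))

/-- The quasi-entropy `S_g(ρ,σ) = Tr ρ^{1/2} g(Δ_{σ,ρ})(ρ^{1/2})`. -/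
def quasiEntropy {n : ℕ} (g : ℝ → ℝ) (ρ σ : CMat n) : ℝ :=
  (msqrt ρ * superCfc g (relModular σ ρ) (msqrt ρ)).trace.re

/-- The generalized relative entropy `H_g(ρ₀,ρ₁) = Tr ρ₀ g(ρ₀^{-1/2} ρ₁ ρ₀^{-1/2})`. -/
def genEntropy {n : ℕ} (g : ℝ → ℝ) (ρ₀ ρ₁ : CMat n) : ℝ :=
  (ρ₀ * cfc g ((msqrt ρ₀)⁻¹ * ρ₁ * (msqrt ρ₀)⁻¹)).trace.re

/-! ### The Wigner–Yanase geodesics -/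

/-- The segment `t ρ₁^{1/2} + (1-t) ρ₀^{1/2}`. -/
def sqrtSegment {n : ℕ} (ρ₀ ρ₁ : CMat n) (t : ℝ) : CMat n :=
  t • msqrt ρ₁ + (1 - t) • msqrt ρ₀

end

open Filter Topology
open scoped RealInnerProductSpace

/-! In an eigenbasis of `ρ` with eigenvalues `a_i`, the WYD form is `λ^α_ρ(h,h) = ∑ c_α(a_i,a_j)
|h_ij|²`, where `c_α(a,b)` is the product of the divided differences of `f_α` and `f_{-α}` at `a,
b`. Writing `a = e^{v+u}`, `b = e^{v-u}` with `u ≠ 0` turns it into `2 e^{-v} sinh⁻²u · (cosh u -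
cosh αu)/(1 - α²)`. The last quotient is a power series in `u²` with coefficients `(1 + α² + ⋯ +
α^{2(k-1)})/(2k)!`, so the metric increases with `α²` (`wydMetric_self_mono`). On `[-3,3]` it is
smallest at `0` and largest at `±3`, where it equals `Tr h ρ⁻¹ h` (`wydMetric_three_self`).
Distances are ordered in the same way, and only the two extremes have to be examined.

At `α = 0`, `f_0 = 2√x`, so `ρ ↦ 2ρ^{1/2}` is an isometry onto its image in Hilbert–Schmidt space
(`curveLength_wyMetric`). Segments between square roots stay positive definite, hence are shortest
on the cone. On densities the square roots lie on the unit sphere, and normalized segments are great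
circle arcs (`arccos_inner_le_lintegral`, `lintegral_norm_deriv_normalized_segm`).

At `α = 3`, let `A = ρ₀^{1/2}` and `Q = (ρ₀^{-1/2} ρ₁ ρ₀^{-1/2})^{1/2}`. For commuting positive
`Z(t)`, the curve `A Z² A = (ZA)*(ZA)` has twice the Euclidean length of `ZA`
(`curveLength_wydMetric_three`). Taking for `ZA` the segment or the great circle arc from `A` to
`QA` gives the upper bounds. Finally `g₀(t) = 2(√t - 1)²` identifies both entropies with squared
Hilbert–Schmidt distances. -/

/-! ### Functional calculus on positive definite matrices: continuity and derivative. -/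

lemma spectrum_subset_Ioi_of_posDef {n : ℕ} {ρ : CMat n} (hρ : ρ.PosDef) :
    spectrum ℝ ρ ⊆ Ioi 0 := by
  rw [hρ.1.spectrum_real_eq_range_eigenvalues]
  rintro _ ⟨i, rfl⟩
  exact hρ.eigenvalues_pos i

lemma continuousOn_cfc_posDefs {n : ℕ} {f : ℝ → ℝ} (hf : ContinuousOn f (Ioi 0)) :
    ContinuousOn (fun ρ : CMat n => cfc f ρ) (posDefs n) := by
  -- Joint continuity of the functional calculus needs a C⋆-norm. The operator norm supplies one and
  -- induces the same topology as the Frobenius norm.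
  open Matrix.Norms.L2Operator in
  have h := continuousOn_cfc_setProd_nhdsSet (𝕜 := ℝ) (A := CMat n) (p := IsSelfAdjoint)
    (s := Ioi 0)
  have h2 := h.comp (g := _) (f := fun ρ : CMat n =>
      (UniformOnFun.ofFun {t : Set ℝ | IsCompact t ∧ t ⊆ Ioi 0} f, ρ)) (s := posDefs n)
    (Continuous.continuousOn (by fun_prop)) (by
      intro ρ hρ
      exact ⟨hf, hρ.1, isOpen_Ioi.mem_nhdsSet.2 (spectrum_subset_Ioi_of_posDef hρ)⟩)
  exact h2

lemma eventually_posDef {n : ℕ} {ρ : CMat n} (hρ : ρ.PosDef) :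
    ∀ᶠ σ in 𝓝 ρ, σ.IsHermitian → σ.PosDef := by
  open Matrix.Norms.L2Operator in
  have h := (upperHemicontinuous_spectrum ℝ (CMat n)).isOpen (Ioi 0)
  have h2 := h.mem_nhds (x := ρ) (isOpen_Ioi.mem_nhdsSet.2 (spectrum_subset_Ioi_of_posDef hρ))
  have h3 : ∀ᶠ σ in 𝓝 ρ, Ioi 0 ∈ 𝓝ˢ (spectrum ℝ σ) := h2
  filter_upwards [h3] with σ hσ hσ'
  rw [hσ'.posDef_iff_eigenvalues_pos]
  intro i
  exact subset_of_mem_nhdsSet hσ (hσ'.spectrum_real_eq_range_eigenvalues ▸ mem_range_self i)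

/-- The spectrum is finite, so every function is continuous on it. This settles the side conditions
of `cfc` for arbitrary functions, including `dslope`. -/
lemma continuousOn_spectrum {m : Type*} [Fintype m] [DecidableEq m] (A : Matrix m m ℂ)
    (f : ℝ → ℝ) : ContinuousOn f (spectrum ℝ A) :=
  A.finite_real_spectrum.continuousOn f

/-- The unitary matrix whose columns are the eigenvectors of `ρ`. -/
noncomputable def eigU {n : ℕ} {ρ : CMat n} (hρ : ρ.IsHermitian) : CMat n :=
  hρ.eigenvectorUnitary

section eigU

variable {n : ℕ} {ρ : CMat n} (hρ : ρ.IsHermitian)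

lemma eigU_conjTranspose_mul : (eigU hρ)ᴴ * eigU hρ = 1 :=
  Unitary.coe_star_mul_self hρ.eigenvectorUnitary

lemma eigU_mul_conjTranspose : eigU hρ * (eigU hρ)ᴴ = 1 :=
  Unitary.coe_mul_star_self hρ.eigenvectorUnitary

lemma cfc_eq_eigU (f : ℝ → ℝ) :
    cfc f ρ = eigU hρ * Matrix.diagonal (fun i => (f (hρ.eigenvalues i) : ℂ)) * (eigU hρ)ᴴ := by
  rw [hρ.cfc_eq, Matrix.IsHermitian.cfc, Unitary.conjStarAlgAut_apply]
  rfl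

lemma eigU_conjTranspose_mul_cfc (f : ℝ → ℝ) :
    (eigU hρ)ᴴ * cfc f ρ = Matrix.diagonal (fun i => (f (hρ.eigenvalues i) : ℂ)) * (eigU hρ)ᴴ := by
  rw [cfc_eq_eigU hρ f, ← mul_assoc, ← mul_assoc, eigU_conjTranspose_mul, one_mul]

lemma eigU_conjTranspose_mul_self :
    (eigU hρ)ᴴ * ρ = Matrix.diagonal (fun i => (hρ.eigenvalues i : ℂ)) * (eigU hρ)ᴴ := by
  have h := eigU_conjTranspose_mul_cfc hρ id
  rwa [cfc_id ℝ ρ (show IsSelfAdjoint ρ from hρ)] at h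

/-- The Daleckii–Krein formula for the derivative of `σ ↦ f(σ)` at `ρ` in the direction `h`. -/
noncomputable def cfcDeriv (f : ℝ → ℝ) (h : CMat n) : CMat n :=
  eigU hρ * Matrix.of (fun i j => ((dslope f (hρ.eigenvalues i) (hρ.eigenvalues j) : ℝ) : ℂ) *
    ((eigU hρ)ᴴ * h * eigU hρ) i j) * (eigU hρ)ᴴ

/-- The Daleckii–Krein formula read row by row: in row `i` one argument of the divided difference is
frozen at the `i`-th eigenvalue, so the other becomes an ordinary function of `ρ`. The shape matches
`eigU_conjTranspose_mul_cfc_sub`. -/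
lemma eigU_conjTranspose_mul_cfcDeriv (f : ℝ → ℝ) (h : CMat n) (i j : Fin n) :
    ((eigU hρ)ᴴ * cfcDeriv hρ f h) i j =
      ((eigU hρ)ᴴ * h * cfc (dslope f (hρ.eigenvalues i)) ρ) i j := by
  rw [cfcDeriv, ← mul_assoc, ← mul_assoc, eigU_conjTranspose_mul, one_mul, cfc_eq_eigU hρ,
    ← mul_assoc, ← mul_assoc, Matrix.mul_apply, Matrix.mul_apply]
  refine Finset.sum_congr rfl fun k _ => ?_
  rw [Matrix.mul_diagonal, Matrix.of_apply, mul_comm (((eigU hρ)ᴴ * h * eigU hρ) i k)]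

lemma cfc_eq_add_sub_mul_dslope {σ : CMat n} (hσ : σ.IsHermitian) (f : ℝ → ℝ) (a : ℝ) :
    cfc f σ = f a • (1 : CMat n) + (σ - a • (1 : CMat n)) * cfc (dslope f a) σ := by
  have hs : IsSelfAdjoint σ := hσ
  have c := continuousOn_spectrum σ
  have h1 : f = fun x => f a + (x - a) * dslope f a x := by
    funext x
    have := sub_smul_dslope f a x
    rw [smul_eq_mul] at this
    rw [this]; ring
  conv_lhs => rw [h1]
  rw [cfc_add σ (fun _ => f a) (fun x => (x - a) * dslope f a x) (c _) (c _),
    cfc_mul (fun x => x - a) (dslope f a) σ (c _) (c _), cfc_const (f a) σ hs,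
    cfc_sub (fun x => x) (fun _ => a) σ (c _) (c _), cfc_const a σ hs, cfc_id' ℝ σ hs,
    Algebra.algebraMap_eq_smul_one, Algebra.algebraMap_eq_smul_one]

/-- Row `i` of `Uᴴ` is a left eigenvector of `ρ`, so on it `f(ρ)` acts as `f(a_i)` and `σ - a_i`
agrees with `σ - ρ`. The identity is exact, and only `σ` enters on the right of the increment, so no
diagonalization of `σ` is needed. -/
lemma eigU_conjTranspose_mul_cfc_sub {σ : CMat n} (hσ : σ.IsHermitian) (f : ℝ → ℝ)
    (i j : Fin n) :
    ((eigU hρ)ᴴ * (cfc f σ - cfc f ρ)) i j =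
      ((eigU hρ)ᴴ * (σ - ρ) * cfc (dslope f (hρ.eigenvalues i)) σ) i j := by
  rw [mul_sub, eigU_conjTranspose_mul_cfc hρ, mul_sub, eigU_conjTranspose_mul_self hρ,
    cfc_eq_add_sub_mul_dslope hσ f (hρ.eigenvalues i), mul_add, sub_mul, sub_mul, mul_sub,
    mul_assoc (Matrix.diagonal _)]
  simp only [Matrix.sub_apply, Matrix.add_apply, Matrix.diagonal_mul, mul_smul_comm, mul_one,
    smul_mul_assoc, one_mul, Matrix.smul_apply, Complex.real_smul, mul_assoc]
  ring

end eigU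

/-- Divide the exact difference formula by `τ - t` and pass to the limit row by row. Besides the
differentiability of `γ`, only the continuity of `σ ↦ f[a_i, ·](σ)` is used. -/
lemma hasDerivWithinAt_cfc {n : ℕ} {f : ℝ → ℝ} (hf : DifferentiableOn ℝ f (Ioi 0))
    {γ : ℝ → CMat n} {h : CMat n} {s : Set ℝ} {t : ℝ} (hγ : HasDerivWithinAt γ h s t)
    (hpos : ∀ᶠ τ in 𝓝[s] t, (γ τ).PosDef) (ht : (γ t).PosDef) :
    HasDerivWithinAt (fun τ => cfc f (γ τ)) (cfcDeriv ht.1 f h) s t := by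
  replace hγ := hasDerivWithinAt_iff_tendsto_slope.1 hγ
  refine hasDerivWithinAt_iff_tendsto_slope.2 ?_
  set U := eigU ht.1 with hU
  have hpos' : ∀ᶠ τ in 𝓝[s \ {t}] t, (γ τ).PosDef :=
    hpos.filter_mono (nhdsWithin_mono _ sdiff_subset)
  have key : Tendsto (fun τ => Uᴴ * slope (fun τ => cfc f (γ τ)) t τ) (𝓝[s \ {t}] t)
      (𝓝 (Uᴴ * cfcDeriv ht.1 f h)) := by
    refine tendsto_pi_nhds.2 fun i => tendsto_pi_nhds.2 fun j => ?_
    have hc : Tendsto γ (𝓝[s \ {t}] t) (𝓝[posDefs n] (γ t)) := by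
      refine tendsto_nhdsWithin_iff.2 ⟨?_, hpos'⟩
      have h1 : Tendsto (fun τ => γ t + (τ - t) • slope γ t τ) (𝓝[s \ {t}] t)
          (𝓝 (γ t + (t - t) • h)) := by
        refine tendsto_const_nhds.add (Tendsto.smul ?_ hγ)
        exact (Continuous.tendsto (by fun_prop) t).mono_left nhdsWithin_le_nhds
      simp only [sub_self, zero_smul, add_zero] at h1
      refine h1.congr fun τ => ?_
      rw [sub_smul_slope]
      simp
    have hd : ContinuousOn (dslope f (ht.1.eigenvalues i)) (Ioi 0) := by
      have hi : Ioi (0 : ℝ) ∈ 𝓝 (ht.1.eigenvalues i) := Ioi_mem_nhds (ht.eigenvalues_pos i)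
      exact (continuousOn_dslope hi).2 ⟨hf.continuousOn, hf.differentiableAt hi⟩
    have h2 := ((continuousOn_cfc_posDefs hd) (γ t) ht).tendsto.comp hc
    have h3 := (tendsto_const_nhds (x := Uᴴ)).mul hγ |>.mul h2
    have h4 := tendsto_pi_nhds.1 (tendsto_pi_nhds.1 h3 i) j
    rw [eigU_conjTranspose_mul_cfcDeriv]
    refine h4.congr' ?_
    filter_upwards [hpos'] with τ hτ
    have := eigU_conjTranspose_mul_cfc_sub ht.1 hτ.1 f i j
    simp only [slope, vsub_eq_sub, mul_smul_comm, smul_mul_assoc, Matrix.smul_apply] at this ⊢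
    rw [this]
    rfl
  have h5 := (tendsto_const_nhds (x := U)).mul key
  simp only [← mul_assoc, hU, eigU_mul_conjTranspose, one_mul] at h5
  exact h5

lemma conj_eigU_apply_symm {n : ℕ} {ρ h : CMat n} (hρ : ρ.IsHermitian) (hh : h.IsHermitian)
    (i j : Fin n) :
    ((eigU hρ)ᴴ * h * eigU hρ) j i = star (((eigU hρ)ᴴ * h * eigU hρ) i j) := by
  have h1 : ((eigU hρ)ᴴ * h * eigU hρ)ᴴ = (eigU hρ)ᴴ * h * eigU hρ := by
    simp only [Matrix.conjTranspose_mul, Matrix.conjTranspose_conjTranspose, hh.eq, mul_assoc]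
  conv_lhs => rw [← h1, Matrix.conjTranspose_apply]

lemma trace_cfcDeriv_mul {n : ℕ} {ρ h : CMat n} (hρ : ρ.IsHermitian) (hh : h.IsHermitian)
    (f g : ℝ → ℝ) :
    (cfcDeriv hρ f h * cfcDeriv hρ g h).trace.re =
      ∑ i, ∑ j, dslope f (hρ.eigenvalues i) (hρ.eigenvalues j) *
        dslope g (hρ.eigenvalues j) (hρ.eigenvalues i) *
        ‖((eigU hρ)ᴴ * h * eigU hρ) i j‖ ^ 2 := by
  have h1 : ∀ A B : CMat n, (eigU hρ * A * (eigU hρ)ᴴ * (eigU hρ * B * (eigU hρ)ᴴ)).trace =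
      (A * B).trace := by
    intro A B
    rw [Matrix.trace_mul_comm, ← mul_assoc]
    rw [Matrix.trace_mul_comm, ← mul_assoc]
    rw [show (eigU hρ)ᴴ * (eigU hρ * B * (eigU hρ)ᴴ) * (eigU hρ * A) =
      ((eigU hρ)ᴴ * eigU hρ) * B * ((eigU hρ)ᴴ * eigU hρ) * A by simp only [mul_assoc]]
    rw [eigU_conjTranspose_mul, one_mul, mul_one, Matrix.trace_mul_comm]
  rw [cfcDeriv, cfcDeriv, h1, Matrix.trace, Complex.re_sum]
  refine Finset.sum_congr rfl fun i _ => ?_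
  rw [Matrix.diag_apply, Matrix.mul_apply, Complex.re_sum]
  refine Finset.sum_congr rfl fun j _ => ?_
  rw [Matrix.of_apply, Matrix.of_apply, conj_eigU_apply_symm hρ hh i j]
  set z := ((eigU hρ)ᴴ * h * eigU hρ) i j
  rw [show ∀ a b : ℂ, a * z * (b * star z) = a * b * (z * star z) by intros; ring]
  rw [show z * star z = ((‖z‖ ^ 2 : ℝ) : ℂ) by
    rw [Complex.star_def, Complex.mul_conj, Complex.normSq_eq_norm_sq]]
  norm_cast

/-! ### The WYD coefficients and their monotonicity in `α²`. -/

/-- The divided difference at `1` and `α²` of `s ↦ cosh (√s u)`. -/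
noncomputable def coshSlope (α u : ℝ) : ℝ :=
  if α ^ 2 = 1 then u * Real.sinh u / 2 else (Real.cosh u - Real.cosh (α * u)) / (1 - α ^ 2)

/-- `cosh(√s u) = ∑ s^k u^{2k}/(2k)!`, and the divided difference of `s^k` at `1` and `α²` is the
geometric sum, including the derivative `k` when `α² = 1`. Monotonicity in `α²` is then visible
termwise. -/
lemma hasSum_coshSlope (α u : ℝ) :
    HasSum (fun k => (∑ j ∈ Finset.range k, (α ^ 2) ^ j) * (u ^ (2 * k) / (2 * k).factorial))
      (coshSlope α u) := by
  by_cases hα : α ^ 2 = 1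
  · simp only [coshSlope, hα, if_true, one_pow, Finset.sum_const, Finset.card_range,
      nsmul_eq_mul, mul_one]
    -- The term `k = 0` has an empty geometric sum; dropping it aligns the series with that of
    -- `sinh`.
    rw [← hasSum_nat_add_iff' 1]
    simp only [Finset.range_one, Finset.sum_singleton, Nat.cast_zero, zero_mul, sub_zero]
    have h := (Real.hasSum_sinh u).mul_left (u / 2)
    rw [show u / 2 * Real.sinh u = u * Real.sinh u / 2 by ring] at h
    refine h.congr_fun fun k => ?_
    rw [show 2 * (k + 1) = (2 * k + 1) + 1 by ring, Nat.factorial_succ]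
    have : ((2 * k + 1).factorial : ℝ) ≠ 0 := by positivity
    have : (k : ℝ) + 1 ≠ 0 := by positivity
    push_cast
    field_simp
    ring
  · have hα' : 1 - α ^ 2 ≠ 0 := fun h => hα (by linarith)
    simp only [coshSlope, hα, if_false]
    have h := ((Real.hasSum_cosh u).sub (Real.hasSum_cosh (α * u))).div_const (1 - α ^ 2)
    refine h.congr_fun fun k => ?_
    rw [geom_sum_eq hα, mul_pow, pow_mul α]
    have : α ^ 2 - 1 ≠ 0 := fun h => hα (by linarith)
    field_simp
    ring

lemma coshSlope_le_coshSlope {α β : ℝ} (h : α ^ 2 ≤ β ^ 2) (u : ℝ) :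
    coshSlope α u ≤ coshSlope β u := by
  refine hasSum_le (fun k => ?_) (hasSum_coshSlope α u) (hasSum_coshSlope β u)
  have : 0 ≤ u ^ (2 * k) / ((2 * k).factorial : ℝ) := by rw [pow_mul]; positivity
  gcongr

lemma coshSlope_three (u : ℝ) : coshSlope 3 u = Real.sinh u ^ 2 * Real.cosh u / 2 := by
  rw [coshSlope, if_neg (by norm_num), Real.cosh_three_mul, Real.sinh_sq]
  ring

lemma wydFun_of_ne {α : ℝ} (hα : α ≠ 1) :
    wydFun α = fun x => 2 / (1 - α) * x ^ ((1 - α) / 2) := by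
  funext x; simp [wydFun, hα]

lemma wydFun_one : wydFun 1 = Real.log := by
  funext x; simp [wydFun]

lemma hasDerivAt_wydFun (α : ℝ) {x : ℝ} (hx : 0 < x) :
    HasDerivAt (wydFun α) (x ^ (-(1 + α) / 2)) x := by
  by_cases hα : α = 1
  · subst hα
    rw [wydFun_one, show (-(1 + 1) / 2 : ℝ) = -1 by norm_num, Real.rpow_neg_one]
    exact Real.hasDerivAt_log hx.ne'
  · rw [wydFun_of_ne hα]
    have h : 1 - α ≠ 0 := fun h => hα (by linarith)
    refine ((Real.hasDerivAt_rpow_const (p := (1 - α) / 2) (Or.inl hx.ne')).const_mul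
      (2 / (1 - α))).congr_deriv ?_
    rw [← mul_assoc, show 2 / (1 - α) * ((1 - α) / 2) = 1 by field_simp, one_mul]
    congr 1; ring

lemma differentiableOn_wydFun (α : ℝ) : DifferentiableOn ℝ (wydFun α) (Ioi 0) :=
  fun _ hx => (hasDerivAt_wydFun α hx).differentiableAt.differentiableWithinAt

lemma dslope_wydFun_mul_self (α : ℝ) {a : ℝ} (ha : 0 < a) :
    dslope (wydFun α) a a * dslope (wydFun (-α)) a a = a⁻¹ := by
  rw [dslope_same, dslope_same, (hasDerivAt_wydFun _ ha).deriv, (hasDerivAt_wydFun _ ha).deriv,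
    ← Real.rpow_add ha, ← Real.rpow_neg_one]
  congr 1; ring

lemma exists_eq_exp_mul_exp {a b : ℝ} (ha : 0 < a) (hb : 0 < b) :
    ∃ v u : ℝ, a = Real.exp (v + u) ∧ b = Real.exp (v - u) :=
  ⟨(Real.log a + Real.log b) / 2, (Real.log a - Real.log b) / 2,
    by ring_nf; rw [Real.exp_log ha], by ring_nf; rw [Real.exp_log hb]⟩

lemma exp_add_sub_exp_sub (v u : ℝ) :
    Real.exp (v + u) - Real.exp (v - u) = 2 * Real.exp v * Real.sinh u := by
  rw [Real.sinh_eq, sub_eq_add_neg v u, Real.exp_add, Real.exp_add]; ring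

lemma wydFun_exp_sub {α : ℝ} (hα : α ≠ 1) (v u : ℝ) :
    wydFun α (Real.exp (v + u)) - wydFun α (Real.exp (v - u)) =
      4 / (1 - α) * Real.exp ((1 - α) / 2 * v) * Real.sinh ((1 - α) / 2 * u) := by
  rw [wydFun_of_ne hα]
  simp only
  rw [← Real.exp_mul, ← Real.exp_mul, ← mul_sub,
    show (v + u) * ((1 - α) / 2) = (1 - α) / 2 * v + (1 - α) / 2 * u by ring,
    show (v - u) * ((1 - α) / 2) = (1 - α) / 2 * v - (1 - α) / 2 * u by ring,
    exp_add_sub_exp_sub]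
  ring

/-- For `α² ≠ 1` this is `2 sinh x sinh y = cosh(x+y) - cosh(x-y)` with `x, y = (1±α)u/2`, so that
`x + y = u` and `x - y = αu`. For `α² = 1` one factor is a difference of logarithms, equal to `2u`.
-/
lemma wydFun_exp_sub_mul (α v u : ℝ) :
    (wydFun α (Real.exp (v + u)) - wydFun α (Real.exp (v - u))) *
      (wydFun (-α) (Real.exp (v + u)) - wydFun (-α) (Real.exp (v - u))) =
      8 * Real.exp v * coshSlope α u := by
  have h1 : (wydFun 1 (Real.exp (v + u)) - wydFun 1 (Real.exp (v - u))) *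
      (wydFun (-1) (Real.exp (v + u)) - wydFun (-1) (Real.exp (v - u))) =
      8 * Real.exp v * (u * Real.sinh u / 2) := by
    rw [wydFun_exp_sub (α := -1) (by norm_num), wydFun_one, Real.log_exp, Real.log_exp]
    norm_num
    ring
  by_cases hα : α ^ 2 = 1
  · rw [coshSlope, if_pos hα]
    rcases sq_eq_sq_iff_eq_or_eq_neg.1 (hα.trans (one_pow 2).symm) with rfl | rfl
    · exact h1
    · rw [neg_neg, mul_comm]; exact h1
  · have ha : α ≠ 1 := fun h => hα (by rw [h]; norm_num)
    have hb : -α ≠ 1 := fun h => hα (by rw [← neg_sq, h]; norm_num)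
    rw [wydFun_exp_sub ha, wydFun_exp_sub hb, coshSlope, if_neg hα]
    have e1 : 1 - α ≠ 0 := fun h => ha (by linarith)
    have e2 : 1 - -α ≠ 0 := fun h => hb (by linarith)
    have e3 : 1 - α ^ 2 ≠ 0 := fun h => hα (by linarith)
    have e4 : Real.exp v = Real.exp ((1 - α) / 2 * v) * Real.exp ((1 - -α) / 2 * v) := by
      rw [← Real.exp_add]; congr 1; ring
    have e5 : Real.cosh u - Real.cosh (α * u) =
        2 * (Real.sinh ((1 - α) / 2 * u) * Real.sinh ((1 - -α) / 2 * u)) := by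
      rw [show u = (1 - -α) / 2 * u + (1 - α) / 2 * u by ring,
        show α * ((1 - -α) / 2 * u + (1 - α) / 2 * u) =
          (1 - -α) / 2 * u - (1 - α) / 2 * u by ring]
      rw [Real.cosh_add, Real.cosh_sub]
      ring_nf
    rw [e4, e5, show 1 - α ^ 2 = (1 - α) * (1 - -α) by ring]
    field_simp
    ring

lemma dslope_wydFun_mul {α v u : ℝ} (hu : u ≠ 0) :
    dslope (wydFun α) (Real.exp (v + u)) (Real.exp (v - u)) *
      dslope (wydFun (-α)) (Real.exp (v - u)) (Real.exp (v + u)) =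
      2 / (Real.exp v * Real.sinh u ^ 2) * coshSlope α u := by
  have hs : Real.sinh u ≠ 0 := Real.sinh_ne_zero.2 hu
  have hv := (Real.exp_pos v).ne'
  have hne : Real.exp (v + u) ≠ Real.exp (v - u) := fun h => by
    have := exp_add_sub_exp_sub v u
    rw [h, sub_self] at this
    exact (mul_ne_zero (mul_ne_zero two_ne_zero hv) hs) this.symm
  rw [dslope_of_ne _ hne.symm, dslope_of_ne _ hne, slope_comm, slope_def_field, slope_def_field,
    div_mul_div_comm, wydFun_exp_sub_mul, exp_add_sub_exp_sub]
  field_simp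
  ring

lemma dslope_wydFun_mul_le {α β : ℝ} (h : α ^ 2 ≤ β ^ 2) {a b : ℝ} (ha : 0 < a) (hb : 0 < b) :
    dslope (wydFun α) a b * dslope (wydFun (-α)) b a ≤
      dslope (wydFun β) a b * dslope (wydFun (-β)) b a := by
  obtain ⟨v, u, rfl, rfl⟩ := exists_eq_exp_mul_exp ha hb
  -- On the diagonal the factor `sinh⁻²u` is meaningless, but there every `α` gives the coefficient
  -- `1/a`.
  by_cases hu : u = 0
  · subst hu
    rw [add_zero, sub_zero, dslope_wydFun_mul_self _ (Real.exp_pos v),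
      dslope_wydFun_mul_self _ (Real.exp_pos v)]
  · rw [dslope_wydFun_mul hu, dslope_wydFun_mul hu]
    have := coshSlope_le_coshSlope h u
    gcongr

lemma dslope_wydFun_three {a b : ℝ} (ha : 0 < a) (hb : 0 < b) :
    dslope (wydFun 3) a b * dslope (wydFun (-3)) b a = (a⁻¹ + b⁻¹) / 2 := by
  obtain ⟨v, u, rfl, rfl⟩ := exists_eq_exp_mul_exp ha hb
  by_cases hu : u = 0
  · subst hu
    rw [add_zero, sub_zero, dslope_wydFun_mul_self _ (Real.exp_pos v)]
    ring
  · have hs : Real.sinh u ≠ 0 := Real.sinh_ne_zero.2 hu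
    rw [dslope_wydFun_mul hu, coshSlope_three, ← Real.exp_neg, ← Real.exp_neg,
      show -(v + u) = -v + -u by ring, show -(v - u) = -v + u by ring, Real.exp_add, Real.exp_add,
      Real.exp_neg v, Real.cosh_eq]
    field_simp
    ring

/-! ### The WYD metrics in an eigenbasis. -/

/-- The real part of the trace, as a continuous real linear functional. -/
noncomputable def reTr (n : ℕ) : CMat n →L[ℝ] ℝ :=
  LinearMap.toContinuousLinearMap (Complex.reLm ∘ₗ Matrix.traceLinearMap (Fin n) ℝ ℂ)

lemma hasDerivAt_cfc_add_smul {n : ℕ} {f : ℝ → ℝ} (hf : DifferentiableOn ℝ f (Ioi 0))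
    {ρ h : CMat n} (hρ : ρ.PosDef) (hh : h.IsHermitian) :
    HasDerivAt (fun t : ℝ => cfc f (ρ + t • h)) (cfcDeriv hρ.1 f h) 0 := by
  have h1 : HasDerivAt (fun t : ℝ => ρ + t • h) h 0 := by
    have := ((hasDerivAt_id (0 : ℝ)).smul_const h).const_add ρ
    rw [one_smul] at this
    exact this
  have h0 : ρ + (0 : ℝ) • h = ρ := by simp
  have h2 : Tendsto (fun t : ℝ => ρ + t • h) (𝓝 0) (𝓝 ρ) := by
    have := h1.continuousAt.tendsto
    rwa [h0] at this
  have h3 : ∀ᶠ t : ℝ in 𝓝[univ] 0, (ρ + t • h).PosDef := by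
    rw [nhdsWithin_univ]
    filter_upwards [h2.eventually (eventually_posDef hρ)] with t ht
    exact ht (hρ.1.add (hh.smul (IsSelfAdjoint.all t)))
  have h4 := hasDerivWithinAt_cfc hf h1.hasDerivWithinAt h3 (by rwa [h0])
  replace h4 := hasDerivWithinAt_univ.1 h4
  have h5 : ∀ (σ : CMat n) (hσ : σ.PosDef), σ = ρ → cfcDeriv hσ.1 f h = cfcDeriv hρ.1 f h := by
    rintro _ _ rfl; rfl
  rw [h5 _ (h0.symm ▸ hρ) h0] at h4
  exact h4

lemma wydMetric_eq {n : ℕ} (α : ℝ) {ρ h k : CMat n} (hρ : ρ.PosDef) (hh : h.IsHermitian)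
    (hk : k.IsHermitian) :
    wydMetric n α ρ h k =
      (cfcDeriv hρ.1 (wydFun α) h * cfcDeriv hρ.1 (wydFun (-α)) k).trace.re := by
  have h1 : ∀ A : CMat n, deriv (fun s : ℝ => (A * cfc (wydFun (-α)) (ρ + s • k)).trace.re) 0 =
      (A * cfcDeriv hρ.1 (wydFun (-α)) k).trace.re := fun A =>
    ((reTr n).hasFDerivAt.comp_hasDerivAt 0
      ((hasDerivAt_cfc_add_smul (differentiableOn_wydFun (-α)) hρ hk).const_mul A)).deriv
  unfold wydMetric
  simp only [h1]
  exact ((reTr n).hasFDerivAt.comp_hasDerivAt 0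
    ((hasDerivAt_cfc_add_smul (differentiableOn_wydFun α) hρ hh).mul_const _)).deriv

lemma wydMetric_self_eq_sum {n : ℕ} (α : ℝ) {ρ h : CMat n} (hρ : ρ.PosDef) (hh : h.IsHermitian) :
    wydMetric n α ρ h h =
      ∑ i, ∑ j, dslope (wydFun α) (hρ.1.eigenvalues i) (hρ.1.eigenvalues j) *
        dslope (wydFun (-α)) (hρ.1.eigenvalues j) (hρ.1.eigenvalues i) *
        ‖((eigU hρ.1)ᴴ * h * eigU hρ.1) i j‖ ^ 2 := by
  rw [wydMetric_eq α hρ hh hh, trace_cfcDeriv_mul hρ.1 hh]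

lemma wydMetric_self_mono {n : ℕ} {α β : ℝ} (hαβ : α ^ 2 ≤ β ^ 2) {ρ h : CMat n} (hρ : ρ.PosDef)
    (hh : h.IsHermitian) : wydMetric n α ρ h h ≤ wydMetric n β ρ h h := by
  rw [wydMetric_self_eq_sum α hρ hh, wydMetric_self_eq_sum β hρ hh]
  exact Finset.sum_le_sum fun i _ => Finset.sum_le_sum fun j _ => mul_le_mul_of_nonneg_right
    (dslope_wydFun_mul_le hαβ (hρ.eigenvalues_pos i) (hρ.eigenvalues_pos j)) (sq_nonneg _)

lemma wydMetric_three_self {n : ℕ} {ρ h : CMat n} (hρ : ρ.PosDef) (hh : h.IsHermitian) :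
    wydMetric n 3 ρ h h = (h * ρ⁻¹ * h).trace.re := by
  rw [wydMetric_self_eq_sum 3 hρ hh]
  set U := eigU hρ.1
  set c : Fin n → Fin n → ℝ := fun i j => ‖(Uᴴ * h * U) i j‖ ^ 2 with hc
  set l := hρ.1.eigenvalues with hl
  have hl0 : ∀ i, l i ≠ 0 := fun i => (hρ.eigenvalues_pos i).ne'
  have hsymm : ∀ i j, c i j = c j i := fun i j => by
    simp only [hc]
    rw [conj_eigU_apply_symm hρ.1 hh i j, norm_star]
  have hinv : ρ⁻¹ = U * Matrix.diagonal (fun i => (((l i)⁻¹ : ℝ) : ℂ)) * Uᴴ := by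
    refine Matrix.inv_eq_left_inv ?_
    rw [mul_assoc, eigU_conjTranspose_mul_self hρ.1, ← mul_assoc, mul_assoc U,
      Matrix.diagonal_mul_diagonal]
    have : (fun i => (((l i)⁻¹ : ℝ) : ℂ) * ((l i : ℝ) : ℂ)) = fun _ => 1 := by
      funext i
      rw [← Complex.ofReal_mul, inv_mul_cancel₀ (hl0 i), Complex.ofReal_one]
    rw [this, Matrix.diagonal_one, mul_one, eigU_mul_conjTranspose]
  have hR : (h * ρ⁻¹ * h).trace.re = ∑ i, ∑ j, (l j)⁻¹ * c i j := by
    have h1 : (h * ρ⁻¹ * h).trace = ((Uᴴ * h * U) *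
        Matrix.diagonal (fun i => (((l i)⁻¹ : ℝ) : ℂ)) * (Uᴴ * h * U)).trace := by
      rw [← mul_assoc _ _ U, Matrix.trace_mul_comm _ U, hinv]
      rw [show U * (Uᴴ * h * U * Matrix.diagonal (fun i => (((l i)⁻¹ : ℝ) : ℂ)) * (Uᴴ * h)) =
        (U * Uᴴ) * h * U * Matrix.diagonal (fun i => (((l i)⁻¹ : ℝ) : ℂ)) * (Uᴴ * h) by
          simp only [mul_assoc], eigU_mul_conjTranspose, one_mul]
      simp only [mul_assoc]
    rw [h1, Matrix.trace, Complex.re_sum]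
    refine Finset.sum_congr rfl fun i _ => ?_
    rw [Matrix.diag_apply, Matrix.mul_apply, Complex.re_sum]
    refine Finset.sum_congr rfl fun j _ => ?_
    rw [Matrix.mul_diagonal, conj_eigU_apply_symm hρ.1 hh i j]
    rw [show ∀ z a : ℂ, z * a * star z = a * (z * star z) by intros; ring, Complex.star_def,
      Complex.mul_conj, Complex.normSq_eq_norm_sq]
    norm_cast
  rw [hR]
  have h2 : ∑ i, ∑ j, (l j)⁻¹ * c i j = ∑ i, ∑ j, (l i)⁻¹ * c i j := by
    rw [Finset.sum_comm]
    exact Finset.sum_congr rfl fun i _ => Finset.sum_congr rfl fun j _ => by rw [hsymm]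
  -- The weights `|h_ij|²` are symmetric, so `1/l_j` may be averaged with `1/l_i`; this is the
  -- coefficient at `α = 3`.
  have h3 : ∑ i, ∑ j, (l j)⁻¹ * c i j =
      ∑ i, ∑ j, ((l i)⁻¹ * c i j + (l j)⁻¹ * c i j) / 2 := by
    simp only [← Finset.sum_div, Finset.sum_add_distrib]
    rw [← h2]
    ring
  rw [h3]
  refine Finset.sum_congr rfl fun i _ => Finset.sum_congr rfl fun j _ => ?_
  rw [dslope_wydFun_three (hρ.eigenvalues_pos i) (hρ.eigenvalues_pos j)]
  ring

/-! ### Lengths of curves and great circle arcs on the unit sphere. -/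

section Sphere


variable {E : Type*} [NormedAddCommGroup E] [InnerProductSpace ℝ E]

lemma inner_deriv_eq_zero_of_norm_eq_one {X : ℝ → E} {X' : E} {t : ℝ}
    (hX : HasDerivWithinAt X X' (Icc 0 1) t) (h1 : ∀ τ ∈ Icc (0 : ℝ) 1, ‖X τ‖ = 1)
    (ht : t ∈ Icc (0 : ℝ) 1) : ⟪X t, X'⟫ = 0 := by
  have h2 : HasDerivWithinAt (fun τ => ‖X τ‖ ^ 2) 0 (Icc 0 1) t :=
    (hasDerivWithinAt_const t (Icc 0 1) (1 : ℝ)).congr (fun τ hτ => by simp [h1 τ hτ])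
      (by simp [h1 t ht])
  have h3 := (uniqueDiffOn_Icc zero_lt_one t ht).eq_deriv _ hX.norm_sq h2
  linarith

/-- The derivative of `arccos (r c(t))` is at most the speed `x`, because `r²(1 - c²) ≤ 1 - r²c²`
for `r < 1`. -/
lemma abs_deriv_arccos_mul_le {r c d x : ℝ} (hr0 : 0 < r) (hr1 : r < 1) (hc : |c| ≤ 1)
    (hd : d ^ 2 ≤ (1 - c ^ 2) * x ^ 2) (hx : 0 ≤ x) :
    |-(1 / Real.sqrt (1 - (r * c) ^ 2)) * (r * d)| ≤ x := by
  have hc2 : c ^ 2 ≤ 1 := (sq_le_one_iff_abs_le_one c).2 hc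
  have h1 : (0 : ℝ) < 1 - (r * c) ^ 2 := by
    rw [mul_pow]
    have : r ^ 2 < 1 := by nlinarith
    nlinarith [sq_nonneg c, sq_nonneg r]
  have hs := Real.sqrt_pos.2 h1
  rw [abs_mul, abs_neg, abs_of_pos (by positivity), one_div, inv_mul_le_iff₀ hs]
  refine abs_le_of_sq_le_sq ?_ (by positivity)
  rw [mul_pow, mul_pow, Real.sq_sqrt h1.le]
  have hr2 : r ^ 2 ≤ 1 := by nlinarith
  calc r ^ 2 * d ^ 2 ≤ r ^ 2 * ((1 - c ^ 2) * x ^ 2) := by gcongr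
    _ ≤ (1 - (r * c) ^ 2) * x ^ 2 := by
      rw [← mul_assoc]
      gcongr
      rw [mul_pow]
      nlinarith

/-- A curve on the unit sphere is at least as long as the angle between its end points. -/
lemma arccos_inner_le_lintegral {X : ℝ → E} (hX : ContDiffOn ℝ 1 X (Icc 0 1))
    (h1 : ∀ τ ∈ Icc (0 : ℝ) 1, ‖X τ‖ = 1) :
    ENNReal.ofReal (Real.arccos ⟪X 0, X 1⟫) ≤
      ∫⁻ t in Icc (0 : ℝ) 1, ENNReal.ofReal ‖derivWithin X (Icc 0 1) t‖ := by
  set c : ℝ → ℝ := fun t => ⟪X 0, X t⟫ with hc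
  have h00 : ‖X 0‖ = 1 := h1 0 (by simp)
  have hcle : ∀ t ∈ Icc (0 : ℝ) 1, |c t| ≤ 1 := fun t ht => by
    have := abs_real_inner_le_norm (X 0) (X t)
    rwa [h00, h1 t ht, one_mul] at this
  have hcC : ContDiffOn ℝ 1 c (Icc 0 1) := contDiffOn_const.inner ℝ hX
  -- `arccos` is not differentiable at `±1`, and `c 0 = 1`. Shrinking its argument by `r < 1` avoids
  -- the singularities; the bound survives `r → 1`.
  have key : ∀ r : ℝ, 0 < r → r < 1 →
      ENNReal.ofReal (Real.arccos (r * c 1) - Real.arccos (r * c 0)) ≤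
        ∫⁻ t in Icc (0 : ℝ) 1, ENNReal.ofReal ‖derivWithin X (Icc 0 1) t‖ := by
    intro r hr0 hr1
    have hlt : ∀ t ∈ Icc (0 : ℝ) 1, |r * c t| < 1 := fun t ht => by
      rw [abs_mul, abs_of_pos hr0]
      nlinarith [hcle t ht, abs_nonneg (c t)]
    have hne : ∀ t ∈ Icc (0 : ℝ) 1, r * c t ≠ -1 ∧ r * c t ≠ 1 := fun t ht =>
      ⟨fun h => by have := hlt t ht; rw [h] at this; norm_num at this,
        fun h => by have := hlt t ht; rw [h] at this; norm_num at this⟩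
    have hφ : ContDiffOn ℝ 1 (fun t => Real.arccos (r * c t)) (Icc 0 1) := fun t ht =>
      ContDiffAt.comp_contDiffWithinAt (g := Real.arccos) (f := fun t => r * c t) t
        (Real.contDiffAt_arccos (hne t ht).1 (hne t ht).2)
        (contDiffWithinAt_const.mul (hcC t ht))
    have h2 := enorm_sub_le_lintegral_derivWithin_Icc_of_contDiffOn_Icc hφ zero_le_one
    refine le_trans ?_ (h2.trans ?_)
    · rw [Real.enorm_eq_ofReal_abs]
      exact ENNReal.ofReal_le_ofReal (le_abs_self _)
    · refine setLIntegral_mono' measurableSet_Icc fun t ht => ?_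
      rw [Real.enorm_eq_ofReal_abs]
      refine ENNReal.ofReal_le_ofReal ?_
      have hd : HasDerivWithinAt X (derivWithin X (Icc 0 1) t) (Icc 0 1) t :=
        ((hX.differentiableOn one_ne_zero) t ht).hasDerivWithinAt
      set X' := derivWithin X (Icc 0 1) t with hX'
      have hcd : HasDerivWithinAt c ⟪X 0, X'⟫ (Icc 0 1) t := by
        have := (hasDerivWithinAt_const t (Icc 0 1) (X 0)).inner ℝ hd
        simpa using this
      have h3 := (Real.hasDerivAt_arccos (hne t ht).1 (hne t ht).2).comp_hasDerivWithinAt t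
        (hcd.const_mul r)
      have h4 := h3.derivWithin (uniqueDiffOn_Icc zero_lt_one t ht)
      rw [show derivWithin (fun t => Real.arccos (r * c t)) (Icc 0 1) t = _ from h4]
      refine abs_deriv_arccos_mul_le hr0 hr1 (hcle t ht) ?_ (norm_nonneg _)
      -- Since `X'` is orthogonal to `X t`, only the component of `X 0` orthogonal to `X t`, of
      -- squared norm `1 - c²`, contributes to `c'`.
      have h5 := inner_deriv_eq_zero_of_norm_eq_one hd h1 ht
      have h6 : ⟪X 0, X'⟫ = ⟪X 0 - c t • X t, X'⟫ := by
        rw [inner_sub_left, real_inner_smul_left, h5]; ring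
      have h7 : ‖X 0 - c t • X t‖ ^ 2 = 1 - c t ^ 2 := by
        rw [norm_sub_sq_real, norm_smul, real_inner_smul_right, h00, h1 t ht, mul_one,
          Real.norm_eq_abs, sq_abs]
        simp only [hc]
        ring
      rw [h6, ← h7, ← mul_pow]
      exact sq_le_sq' (neg_le_of_abs_le (abs_real_inner_le_norm _ _)) (real_inner_le_norm _ _)
  have hc0 : c 0 = 1 := by simp [hc, h00]
  have hlim : Tendsto (fun r : ℝ => ENNReal.ofReal (Real.arccos (r * c 1) - Real.arccos (r * c 0)))
      (𝓝[<] 1) (𝓝 (ENNReal.ofReal (Real.arccos ⟪X 0, X 1⟫))) := by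
    have h8 : Continuous fun r : ℝ =>
        ENNReal.ofReal (Real.arccos (r * c 1) - Real.arccos (r * c 0)) :=
      ENNReal.continuous_ofReal.comp (by fun_prop)
    have h9 := h8.tendsto 1
    rw [show Real.arccos (1 * c 1) - Real.arccos (1 * c 0) = Real.arccos ⟪X 0, X 1⟫ by
      rw [hc0, mul_one, Real.arccos_one, sub_zero, one_mul]] at h9
    exact h9.mono_left nhdsWithin_le_nhds
  refine le_of_tendsto hlim ?_
  filter_upwards [Ioo_mem_nhdsLT (show (0 : ℝ) < 1 by norm_num)] with r hr
  exact key r hr.1 hr.2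

/-- The straight segment from `u` to `v`. -/
def segm (u v : E) (t : ℝ) : E := t • v + (1 - t) • u

lemma norm_segm_sq {u v : E} (hu : ‖u‖ = 1) (hv : ‖v‖ = 1) (t : ℝ) :
    ‖segm u v t‖ ^ 2 = (1 + ⟪u, v⟫) / 2 + (2 * t - 1) ^ 2 * (1 - ⟪u, v⟫) / 2 := by
  rw [segm, norm_add_sq_real, norm_smul, norm_smul, real_inner_smul_left, real_inner_smul_right,
    hu, hv, real_inner_comm, mul_one, mul_one, Real.norm_eq_abs, Real.norm_eq_abs, sq_abs, sq_abs]
  ring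

lemma norm_segm_pos {u v : E} (hu : ‖u‖ = 1) (hv : ‖v‖ = 1) (huv : -1 < ⟪u, v⟫) (t : ℝ) :
    0 < ‖segm u v t‖ := by
  have h1 : ⟪u, v⟫ ≤ 1 := by simpa [hu, hv] using real_inner_le_norm u v
  have h2 := norm_segm_sq hu hv t
  have h3 : 0 < ‖segm u v t‖ ^ 2 := by
    rw [h2]
    have := mul_nonneg (sq_nonneg (2 * t - 1)) (sub_nonneg.2 h1)
    linarith
  exact (norm_nonneg _).lt_of_ne fun h => by rw [← h] at h3; norm_num at h3

lemma hasDerivAt_segm (u v : E) (t : ℝ) : HasDerivAt (segm u v) (v - u) t := by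
  have h1 := ((hasDerivAt_id t).smul_const v).add
    (((hasDerivAt_id t).const_sub 1).smul_const u)
  refine h1.congr_deriv ?_
  rw [one_smul, neg_one_smul, sub_eq_add_neg]

lemma contDiff_segm (u v : E) {k : WithTop ℕ∞} : ContDiff ℝ k (segm u v) := by
  unfold segm
  fun_prop

lemma contDiff_normalized_segm {u v : E} (hu : ‖u‖ = 1) (hv : ‖v‖ = 1) (huv : -1 < ⟪u, v⟫)
    {k : WithTop ℕ∞} : ContDiff ℝ k (fun t => ‖segm u v t‖⁻¹ • segm u v t) := by
  have hne : ∀ t, segm u v t ≠ 0 := fun t => norm_pos_iff.1 (norm_segm_pos hu hv huv t)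
  exact (((contDiff_segm u v).norm ℝ hne).inv fun t => (norm_segm_pos hu hv huv t).ne').smul
    (contDiff_segm u v)

/-- The angular speed of `w` is the area spanned by `w` and `w'` divided by `‖w‖²`. This area is
constant along the line and equals that spanned by `u` and `v`. -/
lemma norm_deriv_normalized_segm {u v : E} (hu : ‖u‖ = 1) (hv : ‖v‖ = 1) (huv : -1 < ⟪u, v⟫)
    (t : ℝ) : ‖deriv (fun t => ‖segm u v t‖⁻¹ • segm u v t) t‖ =
      Real.sqrt (1 - ⟪u, v⟫ ^ 2) / ‖segm u v t‖ ^ 2 := by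
  set w := segm u v with hw
  have hp := norm_segm_pos hu hv huv t
  rw [← hw] at hp
  have h1 : ⟪u, v⟫ ≤ 1 := by simpa [hu, hv] using real_inner_le_norm u v
  have hq := norm_segm_sq hu hv t
  rw [← hw] at hq
  have hd := hasDerivAt_segm u v t
  rw [← hw] at hd
  have hn : HasDerivAt (fun t => ‖w t‖) (⟪w t, v - u⟫ / ‖w t‖) t := by
    have h2 := hd.norm_sq.sqrt (by positivity)
    simp only [Real.sqrt_sq (norm_nonneg _)] at h2
    refine h2.congr_deriv ?_
    field_simp
  have hX := (hn.inv hp.ne').smul hd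
  rw [show deriv (fun t => ‖w t‖⁻¹ • w t) t = _ from hX.deriv]
  have hin : ⟪w t, v - u⟫ = (2 * t - 1) * (1 - ⟪u, v⟫) := by
    rw [hw, segm, inner_add_left, real_inner_smul_left, real_inner_smul_left, inner_sub_right,
      inner_sub_right, real_inner_self_eq_norm_sq, real_inner_self_eq_norm_sq, hu, hv,
      real_inner_comm]
    ring
  have hdd : ‖v - u‖ ^ 2 = 2 * (1 - ⟪u, v⟫) := by
    rw [norm_sub_sq_real, hu, hv, real_inner_comm]; ring
  have hs : 0 ≤ 1 - ⟪u, v⟫ ^ 2 := by nlinarith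
  rw [← sq_eq_sq₀ (norm_nonneg _) (by positivity), norm_add_sq_real, norm_smul, norm_smul,
    real_inner_smul_left, real_inner_smul_right, div_pow, Real.sq_sqrt hs, mul_pow, mul_pow,
    Real.norm_eq_abs, Real.norm_eq_abs, sq_abs, sq_abs, hdd,
    real_inner_comm (w t) (v - u), hin]
  have h3 : (1 - ⟪u, v⟫ ^ 2) = ‖w t‖ ^ 2 * (2 * (1 - ⟪u, v⟫)) -
    ((2 * t - 1) * (1 - ⟪u, v⟫)) ^ 2 := by rw [hq]; ring
  rw [h3]
  simp only [Pi.inv_apply]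
  field_simp
  ring

/-- The half-angle formula `tan²(θ/2) = (1 - cos θ)/(1 + cos θ)`. -/
lemma two_mul_arctan_eq_arccos {c : ℝ} (hc : -1 < c) (hc1 : c ≤ 1) :
    2 * Real.arctan (Real.sqrt ((1 - c) / (1 + c))) = Real.arccos c := by
  set k := Real.sqrt ((1 - c) / (1 + c)) with hk
  have hk0 : 0 ≤ k := Real.sqrt_nonneg _
  have h0 : 0 ≤ Real.arctan k := Real.arctan_nonneg.2 hk0
  have hpi := Real.arctan_lt_pi_div_two k
  have hcos : Real.cos (2 * Real.arctan k) = c := by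
    rw [Real.cos_two_mul, Real.cos_sq_arctan, hk, Real.sq_sqrt
      (div_nonneg (by linarith) (by linarith))]
    have : 1 + c ≠ 0 := by linarith
    field_simp
    ring
  rw [← hcos, Real.arccos_cos (by linarith) (by linarith)]

/-- The length of the great circle arc traced by the normalized segment. -/
lemma lintegral_norm_deriv_normalized_segm {u v : E} (hu : ‖u‖ = 1) (hv : ‖v‖ = 1)
    (huv : -1 < ⟪u, v⟫) :
    ∫⁻ t in Icc (0 : ℝ) 1, ENNReal.ofReal ‖deriv (fun t => ‖segm u v t‖⁻¹ • segm u v t) t‖ =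
      ENNReal.ofReal (Real.arccos ⟪u, v⟫) := by
  set c := ⟪u, v⟫ with hc
  have hc1 : c ≤ 1 := by simpa [hu, hv] using real_inner_le_norm u v
  simp only [norm_deriv_normalized_segm hu hv huv, ← hc]
  set k := Real.sqrt ((1 - c) / (1 + c)) with hk
  have hcpos : 0 < 1 + c := by linarith
  have hksq : k ^ 2 = (1 - c) / (1 + c) := Real.sq_sqrt (div_nonneg (by linarith) (by linarith))
  have hs : Real.sqrt (1 - c ^ 2) = k * (1 + c) := by
    rw [hk, show 1 - c ^ 2 = (1 - c) / (1 + c) * (1 + c) ^ 2 by field_simp; ring,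
      Real.sqrt_mul' _ (by positivity), Real.sqrt_sq (by positivity)]
  -- Here `k = tan(θ/2)` with `θ = arccos c`. The antiderivative is the angle measured from the
  -- midpoint `t = 1/2` of the arc, running from `-θ/2` to `θ/2`.
  have hderiv : ∀ t : ℝ, HasDerivAt (fun t => Real.arctan ((2 * t - 1) * k))
      (Real.sqrt (1 - c ^ 2) / ‖segm u v t‖ ^ 2) t := by
    intro t
    have h1 : HasDerivAt (fun t : ℝ => (2 * t - 1) * k) (2 * k) t := by
      simpa using ((((hasDerivAt_id t).const_mul 2).sub_const 1).mul_const k)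
    refine h1.arctan.congr_deriv ?_
    rw [norm_segm_sq hu hv, ← hc, hs, mul_pow, hksq]
    have : (1 + c) / 2 + (2 * t - 1) ^ 2 * (1 - c) / 2 ≠ 0 := by
      have := mul_nonneg (sq_nonneg (2 * t - 1)) (sub_nonneg.2 hc1)
      exact ne_of_gt (by linarith)
    have : 1 + (2 * t - 1) ^ 2 * ((1 - c) / (1 + c)) ≠ 0 := by
      have := mul_nonneg (sq_nonneg (2 * t - 1)) (div_nonneg (sub_nonneg.2 hc1) hcpos.le)
      exact ne_of_gt (by linarith)
    field_simp
  have hcont : Continuous fun t => Real.sqrt (1 - c ^ 2) / ‖segm u v t‖ ^ 2 := by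
    refine Continuous.div continuous_const
      ((contDiff_segm u v (k := 0)).continuous.norm.pow 2) fun t => ?_
    exact (pow_pos (norm_segm_pos hu hv huv t) 2).ne'
  rw [← ofReal_integral_eq_lintegral_ofReal (hcont.integrableOn_Icc)
    (ae_of_all _ fun t => by positivity), integral_Icc_eq_integral_Ioc,
    ← intervalIntegral.integral_of_le zero_le_one,
    intervalIntegral.integral_eq_sub_of_hasDerivAt (fun t _ => hderiv t)
      (hcont.intervalIntegrable _ _), ← two_mul_arctan_eq_arccos huv hc1]
  congr 1
  rw [show (2 * (0 : ℝ) - 1) * k = -k by ring, show (2 * (1 : ℝ) - 1) * k = k by ring,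
    Real.arctan_neg]
  ring

end Sphere

/-! ### Hilbert–Schmidt geometry and the matrix square root. -/

lemma frobenius_norm_sq {n : ℕ} (x : CMat n) : ‖x‖ ^ 2 = (xᴴ * x).trace.re := by
  rw [Matrix.frobenius_norm_def, ← Real.sqrt_eq_rpow, Real.sq_sqrt (by positivity),
    Finset.sum_comm, Matrix.trace, Complex.re_sum]
  refine Finset.sum_congr rfl fun i _ => ?_
  rw [Matrix.diag_apply, Matrix.mul_apply, Complex.re_sum]
  refine Finset.sum_congr rfl fun j _ => ?_
  rw [Matrix.conjTranspose_apply, mul_comm, Complex.star_def, Complex.mul_conj,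
    Complex.normSq_eq_norm_sq]
  norm_cast

/-- The real Hilbert–Schmidt inner product `Re Tr x* y`. -/
noncomputable instance frobeniusInnerProductSpace (n : ℕ) : InnerProductSpace ℝ (CMat n) where
  inner x y := (xᴴ * y).trace.re
  norm_sq_eq_re_inner x := frobenius_norm_sq x
  conj_inner_symm x y := by
    change (yᴴ * x).trace.re = (xᴴ * y).trace.re
    rw [show yᴴ * x = (xᴴ * y)ᴴ by simp, Matrix.trace_conjTranspose]
    simp
  add_left x y z := by
    rw [Matrix.conjTranspose_add, add_mul, Matrix.trace_add, Complex.add_re]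
  smul_left x y r := by
    rw [Matrix.conjTranspose_smul, smul_mul_assoc, Matrix.trace_smul]
    simp

lemma inner_eq_trace {n : ℕ} (x y : CMat n) : ⟪x, y⟫ = (xᴴ * y).trace.re := rfl

section Sqrt

/-- The index type is general because the lemma also serves for matrices indexed by pairs, which
represent operators on `M_n`. -/
lemma cfc_sqrt_sq {m : Type*} [Fintype m] [DecidableEq m] {B : Matrix m m ℂ}
    (hB : B.PosSemidef) : cfc Real.sqrt (B * B) = B := by
  have hs : IsSelfAdjoint B := hB.1
  have h1 : cfc (fun x : ℝ => x * x) B = B * B := by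
    rw [cfc_mul (fun x => x) (fun x => x) B (continuousOn_spectrum B _)
      (continuousOn_spectrum B _), cfc_id' ℝ B hs]
  rw [← h1, ← cfc_comp Real.sqrt (fun x : ℝ => x * x) B hs
    (((B.finite_real_spectrum).image _).continuousOn _) (continuousOn_spectrum B _)]
  conv_rhs => rw [← cfc_id' ℝ B hs]
  refine cfc_congr fun x hx => ?_
  rw [hB.1.spectrum_real_eq_range_eigenvalues] at hx
  obtain ⟨i, rfl⟩ := hx
  exact Real.sqrt_mul_self (hB.eigenvalues_nonneg i)

variable {n : ℕ} {ρ : CMat n}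

lemma msqrt_sq {X : CMat n} (hX : X.PosDef) : msqrt (X ^ 2) = X := by
  rw [sq]; exact cfc_sqrt_sq hX.posSemidef

lemma isHermitian_cfc (f : ℝ → ℝ) (ρ : CMat n) : (cfc f ρ).IsHermitian :=
  cfc_predicate f ρ

lemma msqrt_mul_self (hρ : ρ.PosDef) : msqrt ρ * msqrt ρ = ρ := by
  have hs : IsSelfAdjoint ρ := hρ.1
  have h1 := cfc_mul Real.sqrt Real.sqrt ρ (continuousOn_spectrum ρ _) (continuousOn_spectrum ρ _)
  refine h1.symm.trans ?_
  conv_rhs => rw [← cfc_id' ℝ ρ hs]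
  exact cfc_congr fun x hx => Real.mul_self_sqrt (spectrum_subset_Ioi_of_posDef hρ hx).le

lemma posDef_msqrt (hρ : ρ.PosDef) : (msqrt ρ).PosDef := by
  have hs : IsSelfAdjoint ρ := hρ.1
  have hh : (msqrt ρ).IsHermitian := isHermitian_cfc _ _
  rw [hh.posDef_iff_eigenvalues_pos]
  intro i
  have h1 : hh.eigenvalues i ∈ spectrum ℝ (msqrt ρ) := hh.eigenvalues_mem_spectrum_real i
  have h2 : spectrum ℝ (msqrt ρ) = Real.sqrt '' spectrum ℝ ρ :=
    cfc_map_spectrum Real.sqrt ρ hs (continuousOn_spectrum ρ _)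
  obtain ⟨x, hx, hxi⟩ := h2 ▸ h1
  rw [← hxi]
  exact Real.sqrt_pos.2 (spectrum_subset_Ioi_of_posDef hρ hx)

lemma dslope_comm (f : ℝ → ℝ) (a b : ℝ) : dslope f a b = dslope f b a := by
  by_cases h : a = b
  · rw [h]
  · rw [dslope_of_ne _ (Ne.symm h), dslope_of_ne _ h, slope_comm]

lemma isHermitian_cfcDeriv (hρ : ρ.IsHermitian) (f : ℝ → ℝ) {h : CMat n} (hh : h.IsHermitian) :
    (cfcDeriv hρ f h).IsHermitian := by
  rw [cfcDeriv]
  refine Matrix.isHermitian_mul_mul_conjTranspose _ ?_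
  ext i j
  rw [Matrix.conjTranspose_apply, Matrix.of_apply, Matrix.of_apply,
    conj_eigU_apply_symm hρ hh i j, star_mul', star_star, dslope_comm]
  simp

lemma wydFun_zero : wydFun 0 = fun x => 2 * Real.sqrt x := by
  rw [wydFun_of_ne (by norm_num)]
  funext x
  rw [Real.sqrt_eq_rpow]
  norm_num

lemma dslope_wydFun_zero (a b : ℝ) : dslope (wydFun 0) a b = 2 * dslope Real.sqrt a b := by
  by_cases h : b = a
  · subst h
    rw [dslope_same, dslope_same, wydFun_zero]
    simp
  · rw [dslope_of_ne _ h, dslope_of_ne _ h, slope_def_field, slope_def_field, wydFun_zero]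
    ring

/-- At `α = 0` both factors of the metric are the derivative of `2√ρ`, so the metric is the
Hilbert–Schmidt metric pulled back by `ρ ↦ 2√ρ`. -/
lemma sqrt_wyMetric_self (hρ : ρ.PosDef) {h : CMat n} (hh : h.IsHermitian) :
    Real.sqrt (wyMetric n ρ h h) = 2 * ‖cfcDeriv hρ.1 Real.sqrt h‖ := by
  have h1 : wyMetric n ρ h h = (2 * ‖cfcDeriv hρ.1 Real.sqrt h‖) ^ 2 := by
    rw [wyMetric, wydMetric_self_eq_sum 0 hρ hh, mul_pow, frobenius_norm_sq,
      (isHermitian_cfcDeriv hρ.1 Real.sqrt hh).eq, trace_cfcDeriv_mul hρ.1 hh, Finset.mul_sum]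
    refine Finset.sum_congr rfl fun i _ => ?_
    rw [Finset.mul_sum]
    refine Finset.sum_congr rfl fun j _ => ?_
    rw [neg_zero, dslope_wydFun_zero, dslope_wydFun_zero]
    ring
  rw [h1, Real.sqrt_sq (by positivity)]

end Sqrt

/-! ### The Sylvester operator, and smoothness and length of square-root curves. -/

section Sylvester

variable {n : ℕ}

/-- The operator `h ↦ A h + h A`. -/
noncomputable def sylv (n : ℕ) : CMat n →L[ℝ] CMat n →L[ℝ] CMat n :=
  ContinuousLinearMap.mul ℝ (CMat n) + (ContinuousLinearMap.mul ℝ (CMat n)).flip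

lemma sylv_apply (A h : CMat n) : sylv n A h = A * h + h * A := rfl

/-- With `S = √A`, pairing `Ah + hA` with `h` gives `‖Sh‖² + ‖hS‖²`. -/
lemma sylv_injective {A : CMat n} (hA : A.PosDef) : Function.Injective (sylv n A) := by
  rw [injective_iff_map_eq_zero]
  intro h hh
  set S := msqrt A with hS
  have hSS : S * S = A := msqrt_mul_self hA
  have hSp : S.PosDef := posDef_msqrt hA
  have h1 : ‖S * h‖ ^ 2 + ‖h * S‖ ^ 2 = 0 := by
    have h2 : (hᴴ * (sylv n A h)).trace.re = 0 := by rw [hh]; simp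
    rw [sylv_apply, mul_add, Matrix.trace_add, Complex.add_re] at h2
    rw [← h2, frobenius_norm_sq, frobenius_norm_sq, Matrix.conjTranspose_mul,
      Matrix.conjTranspose_mul, hSp.1.eq, ← hSS]
    congr 2
    · simp only [mul_assoc]
    · rw [mul_assoc S, Matrix.trace_mul_comm]
      simp only [mul_assoc]
  have h3 : S * h = 0 := by
    rw [← norm_eq_zero, ← sq_eq_zero_iff]
    nlinarith [sq_nonneg ‖S * h‖, sq_nonneg ‖h * S‖]
  exact hSp.isUnit.mul_right_eq_zero.1 h3

/-- `h ↦ A h + h A` as a continuous linear equivalence, for positive definite `A`. -/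
noncomputable def sylvEquiv {A : CMat n} (hA : A.PosDef) : CMat n ≃L[ℝ] CMat n :=
  (LinearEquiv.ofInjectiveEndo (sylv n A).toLinearMap (sylv_injective hA)).toContinuousLinearEquiv

lemma coe_sylvEquiv {A : CMat n} (hA : A.PosDef) :
    (sylvEquiv hA : CMat n →L[ℝ] CMat n) = sylv n A := rfl

end Sylvester

section Curves

variable {n : ℕ} {S : Set (CMat n)} {ρ₀ ρ₁ : CMat n} {γ : ℝ → CMat n}

lemma isHermitian_of_hasDerivWithinAt {h : CMat n} {t : ℝ} (ht : t ∈ Icc (0 : ℝ) 1)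
    (hγ : HasDerivWithinAt γ h (Icc 0 1) t) (hh : ∀ τ ∈ Icc (0 : ℝ) 1, (γ τ).IsHermitian) :
    h.IsHermitian := by
  have h1 : HasDerivWithinAt (fun τ => star (γ τ)) (star h) (Icc 0 1) t := hγ.star
  have h2 : HasDerivWithinAt γ (star h) (Icc 0 1) t :=
    h1.congr (fun τ hτ => (hh τ hτ).eq.symm) (hh t ht).eq.symm
  exact (uniqueDiffOn_Icc zero_lt_one t ht).eq_deriv _ h2 hγ

variable (hγ : ContDiffOn ℝ ∞ γ (Icc 0 1)) (hpos : ∀ t ∈ Icc (0 : ℝ) 1, (γ t).PosDef)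
include hγ

lemma hasDerivWithinAt_curve {t : ℝ} (ht : t ∈ Icc (0 : ℝ) 1) :
    HasDerivWithinAt γ (derivWithin γ (Icc 0 1) t) (Icc 0 1) t :=
  ((hγ.differentiableOn (by simp)) t ht).hasDerivWithinAt

include hpos

lemma isHermitian_derivWithin_curve {t : ℝ} (ht : t ∈ Icc (0 : ℝ) 1) :
    (derivWithin γ (Icc 0 1) t).IsHermitian :=
  isHermitian_of_hasDerivWithinAt ht (hasDerivWithinAt_curve hγ ht) fun τ hτ => (hpos τ hτ).1

lemma hasDerivWithinAt_msqrt_curve {t : ℝ} (ht : t ∈ Icc (0 : ℝ) 1) :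
    HasDerivWithinAt (fun τ => msqrt (γ τ))
      (cfcDeriv (hpos t ht).1 Real.sqrt (derivWithin γ (Icc 0 1) t)) (Icc 0 1) t := by
  refine hasDerivWithinAt_cfc (fun x hx => ?_) (hasDerivWithinAt_curve hγ ht) ?_ (hpos t ht)
  · exact (Real.hasDerivAt_sqrt (ne_of_gt hx)).differentiableAt.differentiableWithinAt
  · filter_upwards [self_mem_nhdsWithin] with τ hτ using hpos τ hτ

/-- The Daleckii–Krein formula gives differentiability, but its eigenbasis may jump with `t`.
Continuity of the derivative comes instead from solving the Sylvester equation `X X' + X' X = γ'`.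
-/
lemma contDiffOn_msqrt_curve : ContDiffOn ℝ 1 (fun τ => msqrt (γ τ)) (Icc 0 1) := by
  set X := fun τ => msqrt (γ τ) with hX
  have hu := uniqueDiffOn_Icc (zero_lt_one (α := ℝ))
  have hd : ∀ t ∈ Icc (0 : ℝ) 1, HasDerivWithinAt X (derivWithin X (Icc 0 1) t) (Icc 0 1) t :=
    fun t ht => (hasDerivWithinAt_msqrt_curve hγ hpos ht).differentiableWithinAt.hasDerivWithinAt
  have hXc : ContinuousOn X (Icc 0 1) := fun t ht => (hd t ht).continuousWithinAt
  have hγc : ContinuousOn (derivWithin γ (Icc 0 1)) (Icc 0 1) :=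
    hγ.continuousOn_derivWithin hu (by simp)
  rw [contDiffOn_one_iff_derivWithin hu]
  refine ⟨fun t ht => (hd t ht).differentiableWithinAt, ?_⟩
  have heq : ∀ t ∈ Icc (0 : ℝ) 1, derivWithin X (Icc 0 1) t =
      (sylv n (X t)).inverse (derivWithin γ (Icc 0 1) t) := by
    intro t ht
    have h1 : HasDerivWithinAt γ (sylv n (X t) (derivWithin X (Icc 0 1) t)) (Icc 0 1) t := by
      have h2 := (hd t ht).mul (hd t ht)
      refine (h2.congr_deriv ?_).congr ?_ ?_
      · rw [sylv_apply, add_comm]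
      · intro τ hτ
        exact (msqrt_mul_self (hpos τ hτ)).symm
      · exact (msqrt_mul_self (hpos t ht)).symm
    have h2 : derivWithin γ (Icc 0 1) t = sylv n (X t) (derivWithin X (Icc 0 1) t) :=
      h1.derivWithin (hu t ht)
    refine Eq.trans ?_ (congrArg _ h2.symm)
    rw [← coe_sylvEquiv (posDef_msqrt (hpos t ht)), ContinuousLinearMap.inverse_equiv]
    exact (ContinuousLinearEquiv.symm_apply_apply _ _).symm
  refine ContinuousOn.congr (fun t ht => ?_) heq
  -- `inverse` is the true inverse here because `X t` is positive definite, and inversion is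
  -- continuous at invertible operators.
  have h3 : ContinuousAt ContinuousLinearMap.inverse (sylv n (X t)) := by
    rw [← coe_sylvEquiv (posDef_msqrt (hpos t ht))]
    exact (contDiffAt_map_inverse (𝕜 := ℝ) (n := 0) _).continuousAt
  have h4 : ContinuousWithinAt (fun τ => (sylv n (X τ)).inverse) (Icc 0 1) t :=
    ContinuousAt.comp_continuousWithinAt (f := fun τ => sylv n (X τ)) h3
      (ContinuousAt.comp_continuousWithinAt (g := sylv n) (f := X)
        (sylv n).continuous.continuousAt (hXc t ht))
  exact h4.clm_apply (hγc t ht)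

lemma curveLength_wyMetric : curveLength (wyMetric n) γ =
    ∫⁻ t in Icc (0 : ℝ) 1,
      ENNReal.ofReal (2 * ‖derivWithin (fun τ => msqrt (γ τ)) (Icc 0 1) t‖) := by
  refine setLIntegral_congr_fun measurableSet_Icc fun t ht => ?_
  have h1 : derivWithin (fun τ => msqrt (γ τ)) (Icc 0 1) t = _ :=
    (hasDerivWithinAt_msqrt_curve hγ hpos ht).derivWithin (uniqueDiffOn_Icc zero_lt_one t ht)
  rw [h1, ← sqrt_wyMetric_self (hpos t ht) (isHermitian_derivWithin_curve hγ hpos ht)]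

lemma curveLength_wydMetric_mono {α β : ℝ} (hαβ : α ^ 2 ≤ β ^ 2) :
    curveLength (wydMetric n α) γ ≤ curveLength (wydMetric n β) γ := by
  refine setLIntegral_mono' measurableSet_Icc fun t ht => ?_
  exact ENNReal.ofReal_le_ofReal (Real.sqrt_le_sqrt
    (wydMetric_self_mono hαβ (hpos t ht) (isHermitian_derivWithin_curve hγ hpos ht)))

end Curves

lemma geodesicDist_wydMetric_mono {n : ℕ} {S : Set (CMat n)} (hS : S ⊆ posDefs n) {α β : ℝ}
    (hαβ : α ^ 2 ≤ β ^ 2) (ρ₀ ρ₁ : CMat n) :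
    geodesicDist (wydMetric n α) S ρ₀ ρ₁ ≤ geodesicDist (wydMetric n β) S ρ₀ ρ₁ :=
  iInf₂_mono fun _ hγ => curveLength_wydMetric_mono hγ.smooth (fun _ ht => hS (hγ.mapsTo ht)) hαβ

/-- Twice the square root turns WY length into Euclidean length, which is at least the distance
between the end points. -/
lemma ofReal_norm_le_curveLength {n : ℕ} {ρ₀ ρ₁ : CMat n} {γ : ℝ → CMat n}
    (hγ : IsCurve (posDefs n) ρ₀ ρ₁ γ) :
    ENNReal.ofReal (2 * ‖msqrt ρ₀ - msqrt ρ₁‖) ≤ curveLength (wyMetric n) γ := by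
  rw [curveLength_wyMetric hγ.smooth hγ.mapsTo]
  have h := enorm_sub_le_lintegral_derivWithin_Icc_of_contDiffOn_Icc
    (contDiffOn_msqrt_curve hγ.smooth hγ.mapsTo) zero_le_one
  rw [hγ.source, hγ.target, ← ofReal_norm, norm_sub_rev] at h
  simp only [ENNReal.ofReal_mul zero_le_two, ← ofReal_norm] at h ⊢
  rw [lintegral_const_mul' _ _ (by simp)]
  gcongr
  exact h

/-- Trace one means that the square root has norm one, so the spherical bound applies to the curve
of square roots. -/
lemma ofReal_arccos_le_curveLength {n : ℕ} {ρ₀ ρ₁ : CMat n} {γ : ℝ → CMat n}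
    (hγ : IsCurve (densities n) ρ₀ ρ₁ γ) :
    ENNReal.ofReal (2 * Real.arccos (msqrt ρ₀ * msqrt ρ₁).trace.re) ≤
      curveLength (wyMetric n) γ := by
  have hpos : ∀ t ∈ Icc (0 : ℝ) 1, (γ t).PosDef := fun t ht => (hγ.mapsTo ht).1
  rw [curveLength_wyMetric hγ.smooth hpos]
  have h1 : ∀ t ∈ Icc (0 : ℝ) 1, ‖msqrt (γ t)‖ = 1 := fun t ht => by
    have h2 : ‖msqrt (γ t)‖ ^ 2 = 1 := by
      rw [frobenius_norm_sq, (posDef_msqrt (hpos t ht)).1.eq, msqrt_mul_self (hpos t ht),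
        (hγ.mapsTo ht).2, Complex.one_re]
    exact (pow_eq_one_iff_of_nonneg (norm_nonneg _) two_ne_zero).1 h2
  have h := arccos_inner_le_lintegral (contDiffOn_msqrt_curve hγ.smooth hpos) h1
  rw [hγ.source, hγ.target, inner_eq_trace] at h
  have h0 : (msqrt ρ₀)ᴴ = msqrt ρ₀ := isHermitian_cfc _ _
  rw [h0] at h
  simp only [ENNReal.ofReal_mul zero_le_two]
  rw [lintegral_const_mul' _ _ (by simp)]
  gcongr
  exact h

/-! ### The explicit Wigner–Yanase geodesics. -/

section Geodesics

variable {n : ℕ}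

lemma posDef_real_smul {A : CMat n} (hA : A.PosDef) {r : ℝ} (hr : 0 < r) : (r • A).PosDef :=
  hA.smul hr

lemma posDef_segm {A B : CMat n} (hA : A.PosDef) (hB : B.PosDef) {t : ℝ}
    (ht : t ∈ Icc (0 : ℝ) 1) : (segm A B t).PosDef := by
  rcases ht.1.eq_or_lt with rfl | h0
  · simpa [segm] using hA
  rcases ht.2.eq_or_lt with rfl | h1
  · simpa [segm] using hB
  exact (posDef_real_smul hB h0).add (posDef_real_smul hA (sub_pos.2 h1))

lemma posDef_sq {A : CMat n} (hA : A.PosDef) : (A ^ 2).PosDef := by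
  have h := Matrix.PosDef.conjTranspose_mul_mul_same (B := A) Matrix.PosDef.one
    (Matrix.mulVec_injective_of_isUnit hA.isUnit)
  rwa [mul_one, hA.1.eq, ← sq] at h

lemma posDef_mul_mul_same {A B : CMat n} (hA : A.PosDef) (hB : B.PosDef) :
    (A * B * A).PosDef := by
  have h := hB.conjTranspose_mul_mul_same (B := A) (Matrix.mulVec_injective_of_isUnit hA.isUnit)
  rwa [hA.1.eq] at h

/-- `Tr AB = ‖√A √B‖²`. Used to exclude antipodal end points, so that the segment can be normalized.
-/
lemma inner_nonneg_of_posDef {A B : CMat n} (hA : A.PosDef) (hB : B.PosDef) : 0 ≤ ⟪A, B⟫ := by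
  have h : (0 : ℝ) ≤ ‖msqrt A * msqrt B‖ ^ 2 := sq_nonneg _
  rw [frobenius_norm_sq, Matrix.conjTranspose_mul, (posDef_msqrt hA).1.eq,
    (posDef_msqrt hB).1.eq] at h
  rw [show msqrt B * msqrt A * (msqrt A * msqrt B) =
    msqrt B * (msqrt A * msqrt A) * msqrt B by simp only [mul_assoc], msqrt_mul_self hA,
    Matrix.trace_mul_comm, ← mul_assoc, msqrt_mul_self hB, Matrix.trace_mul_comm] at h
  rwa [inner_eq_trace, hA.1.eq]

lemma norm_msqrt_of_density {ρ : CMat n} (hρ : ρ ∈ densities n) : ‖msqrt ρ‖ = 1 := by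
  have h2 : ‖msqrt ρ‖ ^ 2 = 1 := by
    rw [frobenius_norm_sq, (posDef_msqrt hρ.1).1.eq, msqrt_mul_self hρ.1, hρ.2, Complex.one_re]
  exact (pow_eq_one_iff_of_nonneg (norm_nonneg _) two_ne_zero).1 h2

lemma trace_eq_one_of_re {ρ : CMat n} (hρ : ρ.IsHermitian) (h : ρ.trace.re = 1) :
    ρ.trace = 1 := by
  refine Complex.ext h ?_
  have h1 : star ρ.trace = ρ.trace := by rw [← Matrix.trace_conjTranspose, hρ.eq]
  simpa using Complex.conj_eq_iff_im.1 h1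

/-- The length of a curve of squares for the Wigner–Yanase metric. -/
lemma curveLength_wyMetric_sq {X : ℝ → CMat n} (hX : ContDiff ℝ ∞ X)
    (hpos : ∀ t ∈ Icc (0 : ℝ) 1, (X t).PosDef) :
    curveLength (wyMetric n) (fun t => X t ^ 2) =
      ∫⁻ t in Icc (0 : ℝ) 1, ENNReal.ofReal (2 * ‖deriv X t‖) := by
  rw [curveLength_wyMetric (γ := fun t => X t ^ 2) (hX.pow 2).contDiffOn
    fun t ht => posDef_sq (hpos t ht)]
  refine setLIntegral_congr_fun measurableSet_Icc fun t ht => ?_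
  have h1 : HasDerivAt X (deriv X t) t := (hX.differentiable (by simp) t).hasDerivAt
  have h2 : HasDerivWithinAt (fun τ => msqrt (X τ ^ 2)) (deriv X t) (Icc 0 1) t :=
    h1.hasDerivWithinAt.congr (fun τ hτ => msqrt_sq (hpos τ hτ)) (msqrt_sq (hpos t ht))
  have h3 : derivWithin (fun τ => msqrt (X τ ^ 2)) (Icc 0 1) t = deriv X t :=
    h2.derivWithin (uniqueDiffOn_Icc zero_lt_one t ht)
  rw [h3]

lemma lintegral_norm_deriv_segm (u v : CMat n) :
    ∫⁻ t in Icc (0 : ℝ) 1, ENNReal.ofReal (2 * ‖deriv (segm u v) t‖) =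
      ENNReal.ofReal (2 * ‖v - u‖) := by
  have h : ∀ t, deriv (segm u v) t = v - u := fun t => (hasDerivAt_segm u v t).deriv
  simp [h]

lemma lintegral_two_mul_norm_deriv_normalized_segm {u v : CMat n} (hu : ‖u‖ = 1) (hv : ‖v‖ = 1)
    (huv : -1 < ⟪u, v⟫) :
    ∫⁻ t in Icc (0 : ℝ) 1,
        ENNReal.ofReal (2 * ‖deriv (fun t => ‖segm u v t‖⁻¹ • segm u v t) t‖) =
      ENNReal.ofReal (2 * Real.arccos ⟪u, v⟫) := by
  simp only [ENNReal.ofReal_mul zero_le_two]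
  rw [lintegral_const_mul' _ _ (by simp)]
  congr 1
  exact lintegral_norm_deriv_normalized_segm hu hv huv

variable {ρ₀ ρ₁ : CMat n}

lemma isCurve_sqrtSegment_sq (h₀ : ρ₀.PosDef) (h₁ : ρ₁.PosDef) :
    IsCurve (posDefs n) ρ₀ ρ₁ (fun t => sqrtSegment ρ₀ ρ₁ t ^ 2) where
  smooth := ((contDiff_segm (msqrt ρ₀) (msqrt ρ₁)).pow 2).contDiffOn
  mapsTo _ ht := posDef_sq (posDef_segm (posDef_msqrt h₀) (posDef_msqrt h₁) ht)
  source := by simp [sqrtSegment, sq, msqrt_mul_self h₀]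
  target := by simp [sqrtSegment, sq, msqrt_mul_self h₁]

lemma curveLength_sqrtSegment_sq (h₀ : ρ₀.PosDef) (h₁ : ρ₁.PosDef) :
    curveLength (wyMetric n) (fun t => sqrtSegment ρ₀ ρ₁ t ^ 2) =
      ENNReal.ofReal (2 * ‖msqrt ρ₀ - msqrt ρ₁‖) := by
  rw [norm_sub_rev, ← lintegral_norm_deriv_segm]
  exact curveLength_wyMetric_sq (contDiff_segm (msqrt ρ₀) (msqrt ρ₁)) fun t ht =>
    posDef_segm (posDef_msqrt h₀) (posDef_msqrt h₁) ht

lemma geodesicDist_eq_of_isGeodesicPath {lam : CMat n → CMat n → CMat n → ℝ} {S : Set (CMat n)}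
    {γ : ℝ → CMat n} (h : IsGeodesicPath lam S ρ₀ ρ₁ γ) :
    geodesicDist lam S ρ₀ ρ₁ = curveLength lam γ :=
  le_antisymm (iInf₂_le γ h.1) (le_iInf₂ h.2)

lemma isGeodesicPath_sqrtSegment_sq (h₀ : ρ₀.PosDef) (h₁ : ρ₁.PosDef) :
    IsGeodesicPath (wyMetric n) (posDefs n) ρ₀ ρ₁ (fun t => sqrtSegment ρ₀ ρ₁ t ^ 2) :=
  ⟨isCurve_sqrtSegment_sq h₀ h₁, fun _ hη => by
    rw [curveLength_sqrtSegment_sq h₀ h₁]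
    exact ofReal_norm_le_curveLength hη⟩

lemma normalized_sqrtSegment_sq (ρ₀ ρ₁ : CMat n) (t : ℝ) :
    (‖sqrtSegment ρ₀ ρ₁ t‖ ^ 2)⁻¹ • sqrtSegment ρ₀ ρ₁ t ^ 2 =
      (‖segm (msqrt ρ₀) (msqrt ρ₁) t‖⁻¹ • segm (msqrt ρ₀) (msqrt ρ₁) t) ^ 2 := by
  rw [smul_pow, inv_pow]
  rfl

lemma neg_one_lt_inner_msqrt (h₀ : ρ₀.PosDef) (h₁ : ρ₁.PosDef) :
    -1 < ⟪msqrt ρ₀, msqrt ρ₁⟫ :=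
  neg_one_lt_zero.trans_le (inner_nonneg_of_posDef (posDef_msqrt h₀) (posDef_msqrt h₁))

lemma norm_normalized_segm {u v : CMat n} (hu : ‖u‖ = 1) (hv : ‖v‖ = 1)
    (huv : -1 < ⟪u, v⟫) (t : ℝ) : ‖‖segm u v t‖⁻¹ • segm u v t‖ = 1 :=
  norm_smul_inv_norm (𝕜 := ℝ) (norm_pos_iff.1 (norm_segm_pos hu hv huv t))

lemma normalized_segm_zero {u v : CMat n} (hu : ‖u‖ = 1) :
    ‖segm u v 0‖⁻¹ • segm u v 0 = u := by simp [segm, hu]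

lemma normalized_segm_one {u v : CMat n} (hv : ‖v‖ = 1) :
    ‖segm u v 1‖⁻¹ • segm u v 1 = v := by simp [segm, hv]

lemma posDef_normalized_segm {u v : CMat n} (hu : ‖u‖ = 1) (hv : ‖v‖ = 1) (huv : -1 < ⟪u, v⟫)
    (hup : u.PosDef) (hvp : v.PosDef) {t : ℝ} (ht : t ∈ Icc (0 : ℝ) 1) :
    (‖segm u v t‖⁻¹ • segm u v t).PosDef :=
  posDef_real_smul (posDef_segm hup hvp ht) (inv_pos.2 (norm_segm_pos hu hv huv t))

lemma isCurve_normalized_sqrtSegment_sq (h₀ : ρ₀ ∈ densities n) (h₁ : ρ₁ ∈ densities n) :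
    IsCurve (densities n) ρ₀ ρ₁
      (fun t => (‖sqrtSegment ρ₀ ρ₁ t‖ ^ 2)⁻¹ • sqrtSegment ρ₀ ρ₁ t ^ 2) := by
  have hu := norm_msqrt_of_density h₀
  have hv := norm_msqrt_of_density h₁
  have huv := neg_one_lt_inner_msqrt h₀.1 h₁.1
  simp only [normalized_sqrtSegment_sq]
  constructor
  · exact ((contDiff_normalized_segm hu hv huv).pow 2).contDiffOn
  · intro t ht
    have hp := posDef_normalized_segm hu hv huv (posDef_msqrt h₀.1) (posDef_msqrt h₁.1) ht
    refine ⟨posDef_sq hp, trace_eq_one_of_re (posDef_sq hp).1 ?_⟩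
    have h := frobenius_norm_sq (‖segm (msqrt ρ₀) (msqrt ρ₁) t‖⁻¹ • segm (msqrt ρ₀) (msqrt ρ₁) t)
    rw [hp.1.eq, norm_normalized_segm hu hv huv, ← sq, one_pow] at h
    exact h.symm
  · rw [normalized_segm_zero hu, sq, msqrt_mul_self h₀.1]
  · rw [normalized_segm_one hv, sq, msqrt_mul_self h₁.1]

lemma curveLength_normalized_sqrtSegment_sq (h₀ : ρ₀ ∈ densities n) (h₁ : ρ₁ ∈ densities n) :
    curveLength (wyMetric n)
      (fun t => (‖sqrtSegment ρ₀ ρ₁ t‖ ^ 2)⁻¹ • sqrtSegment ρ₀ ρ₁ t ^ 2) =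
      ENNReal.ofReal (2 * Real.arccos (msqrt ρ₀ * msqrt ρ₁).trace.re) := by
  have hu := norm_msqrt_of_density h₀
  have hv := norm_msqrt_of_density h₁
  have huv := neg_one_lt_inner_msqrt h₀.1 h₁.1
  simp only [normalized_sqrtSegment_sq]
  rw [curveLength_wyMetric_sq
    (X := fun t => ‖segm (msqrt ρ₀) (msqrt ρ₁) t‖⁻¹ • segm (msqrt ρ₀) (msqrt ρ₁) t)
    (contDiff_normalized_segm hu hv huv) fun t ht =>
      posDef_normalized_segm hu hv huv (posDef_msqrt h₀.1) (posDef_msqrt h₁.1) ht,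
    lintegral_two_mul_norm_deriv_normalized_segm hu hv huv, inner_eq_trace,
    (posDef_msqrt h₀.1).1.eq]

lemma isGeodesicPath_normalized_sqrtSegment_sq (h₀ : ρ₀ ∈ densities n) (h₁ : ρ₁ ∈ densities n) :
    IsGeodesicPath (wyMetric n) (densities n) ρ₀ ρ₁
      (fun t => (‖sqrtSegment ρ₀ ρ₁ t‖ ^ 2)⁻¹ • sqrtSegment ρ₀ ρ₁ t ^ 2) :=
  ⟨isCurve_normalized_sqrtSegment_sq h₀ h₁, fun _ hη => by
    rw [curveLength_normalized_sqrtSegment_sq h₀ h₁]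
    exact ofReal_arccos_le_curveLength hη⟩

end Geodesics

/-! ### Upper bounds from curves `A Z² A` for the metric with `α = 3`. -/

section UpperBound

variable {n : ℕ}

lemma commute_deriv {Z : ℝ → CMat n} (hZ : Differentiable ℝ Z)
    (hc : ∀ s t, Commute (Z s) (Z t)) (t : ℝ) : Commute (Z t) (deriv Z t) := by
  have h1 : HasDerivAt Z (deriv Z t) t := (hZ t).hasDerivAt
  have h2 := h1.const_mul (Z t)
  have h3 := h1.mul_const (Z t)
  have h4 : (fun s => Z t * Z s) = fun s => Z s * Z t := funext fun s => hc t s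
  rw [h4] at h2
  exact h2.unique h3

/-- The length of `t ↦ A Z(t)² A` for the maximal metric, where the `Z(t)` commute. -/
lemma curveLength_wydMetric_three {A : CMat n} (hA : A.PosDef) {Z : ℝ → CMat n}
    (hZ : ContDiff ℝ ∞ Z) (hpos : ∀ t ∈ Icc (0 : ℝ) 1, (Z t).PosDef)
    (hc : ∀ s t, Commute (Z s) (Z t)) :
    curveLength (wydMetric n 3) (fun t => A * Z t ^ 2 * A) =
      ∫⁻ t in Icc (0 : ℝ) 1, ENNReal.ofReal (2 * ‖deriv (fun t => Z t * A) t‖) := by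
  refine setLIntegral_congr_fun measurableSet_Icc fun t ht => ?_
  have hdZ : Differentiable ℝ Z := hZ.differentiable (by simp)
  have h1 : HasDerivAt Z (deriv Z t) t := (hdZ t).hasDerivAt
  have hcomm := commute_deriv hdZ hc t
  have hherm : (deriv Z t).IsHermitian :=
    isHermitian_of_hasDerivWithinAt ht h1.hasDerivWithinAt fun τ hτ => (hpos τ hτ).1
  set D := deriv Z t with hD
  have hγ : HasDerivAt (fun t => A * Z t ^ 2 * A) (2 • (A * (Z t * D) * A)) t := by
    have h2 : HasDerivAt (fun t => Z t * Z t) (D * Z t + Z t * D) t := h1.mul h1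
    have h3 := (h2.const_mul A).mul_const A
    rw [← hcomm.eq, ← two_smul ℕ, mul_smul_comm, smul_mul_assoc] at h3
    simp only [sq]
    exact h3
  have hγ' : derivWithin (fun t => A * Z t ^ 2 * A) (Icc 0 1) t = 2 • (A * (Z t * D) * A) :=
    hγ.hasDerivWithinAt.derivWithin (uniqueDiffOn_Icc zero_lt_one t ht)
  have hX : deriv (fun t => Z t * A) t = D * A := (h1.mul_const A).deriv
  have hp : (A * Z t ^ 2 * A).PosDef := posDef_mul_mul_same hA (posDef_sq (hpos t ht))
  have hh : (2 • (A * (Z t * D) * A)).IsHermitian := by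
    rw [two_smul]
    have h4 : (A * (Z t * D) * A).IsHermitian := by
      rw [Matrix.IsHermitian, Matrix.conjTranspose_mul, Matrix.conjTranspose_mul,
        Matrix.conjTranspose_mul, hA.1.eq, (hpos t ht).1.eq, hherm.eq, ← hcomm.eq]
      simp only [mul_assoc]
    exact h4.add h4
  have hAu : IsUnit A.det := (Matrix.isUnit_iff_isUnit_det A).1 hA.isUnit
  have hZu : IsUnit (Z t).det := (Matrix.isUnit_iff_isUnit_det _).1 (hpos t ht).isUnit
  have hpu : IsUnit (A * Z t ^ 2 * A).det := (Matrix.isUnit_iff_isUnit_det _).1 hp.isUnit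
  -- One factor `Z` of the derivative cancels in `γ⁻¹ γ' = 2 A⁻¹ Z⁻¹ D A`. As `Z` and `D` commute,
  -- multiplying by `γ'` leaves `4 (DA)ᴴ (DA)`.
  have hinv : (A * Z t ^ 2 * A)⁻¹ * (A * (Z t * D) * A) = A⁻¹ * ((Z t)⁻¹ * (D * A)) := by
    have h5 : A * (Z t * D) * A = (A * Z t ^ 2 * A) * (A⁻¹ * ((Z t)⁻¹ * (D * A))) := by
      simp only [sq, mul_assoc, Matrix.mul_nonsing_inv_cancel_left _ _ hAu,
        Matrix.mul_nonsing_inv_cancel_left _ _ hZu]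
    rw [h5, Matrix.nonsing_inv_mul_cancel_left _ _ hpu]
  have htr : (2 • (A * (Z t * D) * A) * (A * Z t ^ 2 * A)⁻¹ * 2 • (A * (Z t * D) * A)).trace.re =
      (2 * ‖D * A‖) ^ 2 := by
    have h6 : A * (Z t * D) * A * (A⁻¹ * ((Z t)⁻¹ * (D * A))) = (D * A)ᴴ * (D * A) := by
      rw [hcomm.eq, Matrix.conjTranspose_mul, hA.1.eq, hherm.eq]
      simp only [mul_assoc, Matrix.mul_nonsing_inv_cancel_left _ _ hAu,
        Matrix.mul_nonsing_inv_cancel_left _ _ hZu]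
    rw [mul_smul_comm, smul_mul_assoc, smul_mul_assoc, mul_assoc (A * (Z t * D) * A), hinv,
      h6, mul_pow, frobenius_norm_sq, Matrix.trace_smul, Matrix.trace_smul]
    simp only [nsmul_eq_mul, Nat.cast_ofNat, Complex.mul_re, Complex.re_ofNat, Complex.im_ofNat,
      zero_mul, sub_zero]
    ring
  rw [hγ', hX, wydMetric_three_self hp hh, htr, Real.sqrt_sq (by positivity)]

/-- The matrix `ρ₀^{-1/2} ρ₁ ρ₀^{-1/2}`. -/
noncomputable def relMat (ρ₀ ρ₁ : CMat n) : CMat n := (msqrt ρ₀)⁻¹ * ρ₁ * (msqrt ρ₀)⁻¹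

variable {ρ₀ ρ₁ : CMat n}

lemma posDef_relMat (h₀ : ρ₀.PosDef) (h₁ : ρ₁.PosDef) : (relMat ρ₀ ρ₁).PosDef :=
  posDef_mul_mul_same (posDef_msqrt h₀).inv h₁

lemma isUnit_det_msqrt (h₀ : ρ₀.PosDef) : IsUnit (msqrt ρ₀).det :=
  (Matrix.isUnit_iff_isUnit_det _).1 (posDef_msqrt h₀).isUnit

lemma msqrt_mul_relMat_mul (h₀ : ρ₀.PosDef) (ρ₁ : CMat n) :
    msqrt ρ₀ * relMat ρ₀ ρ₁ * msqrt ρ₀ = ρ₁ := by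
  rw [relMat, mul_assoc, Matrix.nonsing_inv_mul_cancel_right _ _ (isUnit_det_msqrt h₀),
    Matrix.mul_nonsing_inv_cancel_left _ _ (isUnit_det_msqrt h₀)]

lemma commute_segm_one (Q : CMat n) (s t : ℝ) : Commute (segm 1 Q s) (segm 1 Q t) := by
  have h1 : ∀ t : ℝ, Commute Q (segm 1 Q t) := fun t =>
    ((Commute.refl Q).smul_right t).add_right ((Commute.one_right Q).smul_right (1 - t))
  exact ((h1 t).smul_left s).add_left ((Commute.one_left _).smul_left (1 - s))

lemma segm_one_mul (Q A : CMat n) (t : ℝ) : segm 1 Q t * A = segm A (Q * A) t := by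
  simp only [segm, add_mul, smul_mul_assoc, one_mul]

/-- The test curve is `A Z² A` with `Z` the segment from `1` to `Q`; then `ZA` is the straight
segment from `A` to `QA`. -/
lemma geodesicDist_wydMetric_three_le (h₀ : ρ₀.PosDef) (h₁ : ρ₁.PosDef) :
    geodesicDist (wydMetric n 3) (posDefs n) ρ₀ ρ₁ ≤
      ENNReal.ofReal (2 * ‖msqrt (relMat ρ₀ ρ₁) * msqrt ρ₀ - msqrt ρ₀‖) := by
  set A := msqrt ρ₀ with hAdef
  set Q := msqrt (relMat ρ₀ ρ₁) with hQdef
  have hA : A.PosDef := posDef_msqrt h₀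
  have hQ : Q.PosDef := posDef_msqrt (posDef_relMat h₀ h₁)
  have hpos : ∀ t ∈ Icc (0 : ℝ) 1, (segm 1 Q t).PosDef := fun t ht =>
    posDef_segm Matrix.PosDef.one hQ ht
  have hcurve : IsCurve (posDefs n) ρ₀ ρ₁ (fun t => A * segm 1 Q t ^ 2 * A) := by
    refine ⟨?_, fun t ht => posDef_mul_mul_same hA (posDef_sq (hpos t ht)), ?_, ?_⟩
    · exact ((contDiff_const.mul ((contDiff_segm 1 Q).pow 2)).mul contDiff_const).contDiffOn
    · simp [segm, hAdef, msqrt_mul_self h₀]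
    · simp only [segm, one_smul, sub_self, zero_smul, add_zero, sq]
      rw [hQdef, msqrt_mul_self (posDef_relMat h₀ h₁), hAdef, msqrt_mul_relMat_mul h₀]
  refine (iInf₂_le _ hcurve).trans_eq ?_
  rw [curveLength_wydMetric_three hA (contDiff_segm 1 Q) hpos (commute_segm_one Q)]
  simp only [segm_one_mul]
  exact lintegral_norm_deriv_segm A (Q * A)

lemma norm_msqrt_relMat_mul (h₀ : ρ₀ ∈ densities n) (h₁ : ρ₁ ∈ densities n) :
    ‖msqrt (relMat ρ₀ ρ₁) * msqrt ρ₀‖ = 1 := by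
  have hQ := posDef_relMat h₀.1 h₁.1
  have h2 : ‖msqrt (relMat ρ₀ ρ₁) * msqrt ρ₀‖ ^ 2 = 1 := by
    rw [frobenius_norm_sq, Matrix.conjTranspose_mul, (posDef_msqrt h₀.1).1.eq,
      (posDef_msqrt hQ).1.eq, mul_assoc, ← mul_assoc (msqrt (relMat ρ₀ ρ₁)), msqrt_mul_self hQ,
      ← mul_assoc, msqrt_mul_relMat_mul h₀.1, h₁.2, Complex.one_re]
  exact (pow_eq_one_iff_of_nonneg (norm_nonneg _) two_ne_zero).1 h2

/-- The geometric mean enters the spherical bound as the cosine of the angle between `A` and `QA`.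
-/
lemma inner_msqrt_eq_geomMean (h₀ : ρ₀.PosDef) (ρ₁ : CMat n) :
    ⟪msqrt ρ₀, msqrt (relMat ρ₀ ρ₁) * msqrt ρ₀⟫ = (geomMean ρ₀ ρ₁).trace.re := by
  rw [inner_eq_trace, (posDef_msqrt h₀).1.eq, ← mul_assoc]
  rfl

lemma trace_geomMean_nonneg (h₀ : ρ₀.PosDef) (h₁ : ρ₁.PosDef) :
    0 ≤ (geomMean ρ₀ ρ₁).trace.re := by
  have h : (geomMean ρ₀ ρ₁).PosDef :=
    posDef_mul_mul_same (posDef_msqrt h₀) (posDef_msqrt (posDef_relMat h₀ h₁))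
  exact (Complex.nonneg_iff.1 h.posSemidef.trace_nonneg).1

lemma geodesicDist_densities_wydMetric_three_le (h₀ : ρ₀ ∈ densities n) (h₁ : ρ₁ ∈ densities n) :
    geodesicDist (wydMetric n 3) (densities n) ρ₀ ρ₁ ≤
      ENNReal.ofReal (2 * Real.arccos (geomMean ρ₀ ρ₁).trace.re) := by
  have huv : -1 < ⟪msqrt ρ₀, msqrt (relMat ρ₀ ρ₁) * msqrt ρ₀⟫ := by
    rw [inner_msqrt_eq_geomMean h₀.1]
    exact neg_one_lt_zero.trans_le (trace_geomMean_nonneg h₀.1 h₁.1)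
  have hu := norm_msqrt_of_density h₀
  have hv := norm_msqrt_relMat_mul h₀ h₁
  rw [← inner_msqrt_eq_geomMean h₀.1]
  set A := msqrt ρ₀ with hAdef
  set Q := msqrt (relMat ρ₀ ρ₁) with hQdef
  have hA : A.PosDef := posDef_msqrt h₀.1
  have hQ : Q.PosDef := posDef_msqrt (posDef_relMat h₀.1 h₁.1)
  -- The scalar factor puts `ZA` on the unit sphere, where it traces the arc from `A` to `QA`, and
  -- preserves commutation. Unit norm of `ZA` is exactly trace one of `A Z² A`.
  set Z : ℝ → CMat n := fun t => ‖segm A (Q * A) t‖⁻¹ • segm 1 Q t with hZdef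
  have hZA : ∀ t, Z t * A = ‖segm A (Q * A) t‖⁻¹ • segm A (Q * A) t := fun t => by
    rw [hZdef, smul_mul_assoc, segm_one_mul]
  have hpos : ∀ t ∈ Icc (0 : ℝ) 1, (Z t).PosDef := fun t ht =>
    posDef_real_smul (posDef_segm Matrix.PosDef.one hQ ht) (inv_pos.2 (norm_segm_pos hu hv huv t))
  have hZ : ContDiff ℝ ∞ Z := by
    have hne : ∀ t, segm A (Q * A) t ≠ 0 := fun t => norm_pos_iff.1 (norm_segm_pos hu hv huv t)
    exact (((contDiff_segm A (Q * A)).norm ℝ hne).inv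
      fun t => (norm_segm_pos hu hv huv t).ne').smul (contDiff_segm 1 Q)
  have hsq : ∀ t ∈ Icc (0 : ℝ) 1, A * Z t ^ 2 * A = (Z t * A)ᴴ * (Z t * A) := fun t ht => by
    rw [Matrix.conjTranspose_mul, hA.1.eq, (hpos t ht).1.eq, sq]
    simp only [mul_assoc]
  have hcurve : IsCurve (densities n) ρ₀ ρ₁ (fun t => A * Z t ^ 2 * A) := by
    refine ⟨?_, fun t ht => ?_, ?_, ?_⟩
    · exact ((contDiff_const.mul (hZ.pow 2)).mul contDiff_const).contDiffOn
    · have hp := posDef_mul_mul_same hA (posDef_sq (hpos t ht))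
      refine ⟨hp, trace_eq_one_of_re hp.1 ?_⟩
      rw [hsq t ht, ← frobenius_norm_sq, hZA, norm_normalized_segm hu hv huv, one_pow]
    · rw [hsq 0 (by simp), hZA, normalized_segm_zero hu, hA.1.eq, hAdef, msqrt_mul_self h₀.1]
    · rw [hsq 1 (by simp), hZA, normalized_segm_one hv, Matrix.conjTranspose_mul, hA.1.eq, hQ.1.eq,
        mul_assoc, ← mul_assoc Q, hQdef, msqrt_mul_self (posDef_relMat h₀.1 h₁.1), hAdef,
        ← mul_assoc, msqrt_mul_relMat_mul h₀.1]
  refine (iInf₂_le _ hcurve).trans_eq ?_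
  rw [curveLength_wydMetric_three hA hZ hpos fun s t =>
    ((commute_segm_one Q s t).smul_left _).smul_right _]
  simp only [hZA]
  exact lintegral_two_mul_norm_deriv_normalized_segm hu hv huv

end UpperBound

/-! ### The entropies of `g₀` as squared Hilbert–Schmidt distances. -/

section Entropies

lemma cfc_gZero {m : Type*} [Fintype m] [DecidableEq m] {M : Matrix m m ℂ}
    (hM : M.IsHermitian) :
    cfc gZero M = (2 : ℝ) • (1 : Matrix m m ℂ) + (2 : ℝ) • M - (4 : ℝ) • cfc Real.sqrt M := by
  have hs : IsSelfAdjoint M := hM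
  have c := continuousOn_spectrum M
  change cfc (fun t => 2 + 2 * t - 4 * Real.sqrt t) M = _
  rw [cfc_sub (fun t => 2 + 2 * t) (fun t => 4 * Real.sqrt t) M (c _) (c _),
    cfc_add M (fun _ => 2) (fun t => 2 * t) (c _) (c _), cfc_const _ M hs,
    cfc_const_mul 2 (fun t => t) M (c _), cfc_const_mul 4 Real.sqrt M (c _), cfc_id' ℝ M hs,
    Algebra.algebraMap_eq_smul_one]

variable {n : ℕ} {ρ₀ ρ₁ : CMat n}

/-- `g₀(t) = 2(√t - 1)²`, so `g₀(Q²) = 2(Q - 1)²`, and `Tr A²(Q - 1)² = ‖(Q - 1)A‖²`. -/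
lemma genEntropy_gZero (h₀ : ρ₀.PosDef) (h₁ : ρ₁.PosDef) :
    genEntropy gZero ρ₀ ρ₁ = 2 * ‖msqrt (relMat ρ₀ ρ₁) * msqrt ρ₀ - msqrt ρ₀‖ ^ 2 := by
  have hC := posDef_relMat h₀ h₁
  change (ρ₀ * cfc gZero (relMat ρ₀ ρ₁)).trace.re = _
  rw [cfc_gZero hC.1]
  change (ρ₀ * ((2 : ℝ) • (1 : CMat n) + (2 : ℝ) • relMat ρ₀ ρ₁ -
    (4 : ℝ) • msqrt (relMat ρ₀ ρ₁))).trace.re = _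
  set A := msqrt ρ₀ with hA
  set Q := msqrt (relMat ρ₀ ρ₁) with hQ
  have hQQ : Q * Q = relMat ρ₀ ρ₁ := msqrt_mul_self hC
  have hAA : A * A = ρ₀ := msqrt_mul_self h₀
  have h2 : (2 : ℝ) • (1 : CMat n) + (2 : ℝ) • relMat ρ₀ ρ₁ - (4 : ℝ) • Q =
      (2 : ℝ) • ((Q - 1) * (Q - 1)) := by
    rw [sub_mul, mul_sub, mul_sub, hQQ, one_mul, mul_one, mul_one]
    module
  have hAh : Aᴴ = A := (posDef_msqrt h₀).1.eq
  have hQh : Qᴴ = Q := (posDef_msqrt hC).1.eq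
  rw [h2, mul_smul_comm, Matrix.trace_smul, Complex.smul_re, smul_eq_mul, frobenius_norm_sq,
    show Q * A - A = (Q - 1) * A by rw [sub_mul, one_mul], Matrix.conjTranspose_mul,
    Matrix.conjTranspose_sub, Matrix.conjTranspose_one, hAh, hQh, mul_assoc A,
    Matrix.trace_mul_comm A, ← hAA, Matrix.trace_mul_comm]
  simp only [mul_assoc]

/-- The Kronecker form makes positivity of the modular operator evident. -/
lemma toMatrix_relModular (S T : CMat n) :
    LinearMap.toMatrix (Matrix.stdBasis ℂ (Fin n) (Fin n)) (Matrix.stdBasis ℂ (Fin n) (Fin n))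
      (relModular S T) = Matrix.kronecker S (T⁻¹)ᵀ := by
  ext ⟨i, j⟩ ⟨k, l⟩
  rw [LinearMap.toMatrix_apply, Matrix.stdBasis_eq_single]
  change (S * (Matrix.single k l 1 * T⁻¹) : CMat n) i j = S i k * T⁻¹ l j
  simp [Matrix.mul_apply, Matrix.single_apply, ite_and]

/-- Left and right multiplications commute, so the modular operator of `ρ₁, ρ₀` is the square of
that of their square roots. The latter is positive, hence is the square root required by `g₀`. -/
lemma superCfc_gZero_relModular (h₀ : ρ₀.PosDef) (h₁ : ρ₁.PosDef) (x : CMat n) :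
    superCfc gZero (relModular ρ₁ ρ₀) x =
      (2 : ℝ) • x + (2 : ℝ) • (ρ₁ * x * ρ₀⁻¹) -
        (4 : ℝ) • (msqrt ρ₁ * x * (msqrt ρ₀)⁻¹) := by
  set b := Matrix.stdBasis ℂ (Fin n) (Fin n) with hb
  set B := LinearMap.toMatrix b b (relModular (msqrt ρ₁) (msqrt ρ₀)) with hB
  have hBpos : B.PosSemidef := by
    rw [hB, toMatrix_relModular]
    exact (posDef_msqrt h₁).posSemidef.kronecker (posDef_msqrt h₀).inv.posSemidef.transpose
  have hBB : LinearMap.toMatrix b b (relModular ρ₁ ρ₀) = B * B := by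
    rw [hB, ← LinearMap.toMatrix_comp]
    congr 1
    ext1 y
    change ρ₁ * (y * ρ₀⁻¹) =
      msqrt ρ₁ * ((msqrt ρ₁ * (y * (msqrt ρ₀)⁻¹)) * (msqrt ρ₀)⁻¹)
    conv_lhs => rw [← msqrt_mul_self h₀, ← msqrt_mul_self h₁, Matrix.mul_inv_rev]
    simp only [mul_assoc]
  have hBherm : (B * B).IsHermitian := by
    rw [Matrix.IsHermitian, Matrix.conjTranspose_mul, hBpos.1.eq]
  rw [superCfc, ← hb, hBB, cfc_gZero hBherm, cfc_sqrt_sq hBpos, ← hBB]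
  have h2 : ∀ (r : ℝ) (M : Matrix (Fin n × Fin n) (Fin n × Fin n) ℂ),
      Matrix.toLin b b (r • M) x = r • Matrix.toLin b b M x := fun r M => by
    rw [← Complex.coe_smul, map_smul, LinearMap.smul_apply, Complex.coe_smul]
  rw [map_sub, map_add, LinearMap.sub_apply, LinearMap.add_apply, h2, h2, h2, Matrix.toLin_one,
    hB, Matrix.toLin_toMatrix, Matrix.toLin_toMatrix]
  simp only [relModular, LinearMap.comp_apply, LinearMap.id_apply, LinearMap.mulLeft_apply,
    LinearMap.mulRight_apply, mul_assoc]

/-- Applied to `√ρ₀`, the factor `(√ρ₀)⁻¹` cancels, and the trace expands to `2 Tr ρ₀ + 2 Tr ρ₁ - 4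
Re Tr √ρ₀ √ρ₁`. -/
lemma quasiEntropy_gZero (h₀ : ρ₀.PosDef) (h₁ : ρ₁.PosDef) :
    quasiEntropy gZero ρ₀ ρ₁ = 2 * ‖msqrt ρ₀ - msqrt ρ₁‖ ^ 2 := by
  rw [quasiEntropy, superCfc_gZero_relModular h₀ h₁]
  have hA0 : msqrt ρ₀ * msqrt ρ₀ = ρ₀ := msqrt_mul_self h₀
  have hA1 : msqrt ρ₁ * msqrt ρ₁ = ρ₁ := msqrt_mul_self h₁
  have hAu := isUnit_det_msqrt h₀
  have hinv : ρ₀⁻¹ = (msqrt ρ₀)⁻¹ * (msqrt ρ₀)⁻¹ := by rw [← Matrix.mul_inv_rev, hA0]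
  have h3 : msqrt ρ₀ * ρ₀⁻¹ = (msqrt ρ₀)⁻¹ := by
    rw [hinv, Matrix.mul_nonsing_inv_cancel_left _ _ hAu]
  rw [mul_assoc ρ₁, h3, Matrix.mul_nonsing_inv_cancel_right _ _ hAu, mul_sub, mul_add,
    mul_smul_comm, mul_smul_comm, mul_smul_comm, hA0, Matrix.trace_sub, Matrix.trace_add,
    Matrix.trace_smul, Matrix.trace_smul, Matrix.trace_smul, Matrix.trace_mul_comm _ (ρ₁ * _),
    Matrix.nonsing_inv_mul_cancel_right _ _ hAu, norm_sub_sq_real, frobenius_norm_sq,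
    frobenius_norm_sq, inner_eq_trace, (posDef_msqrt h₀).1.eq, (posDef_msqrt h₁).1.eq, hA0, hA1]
  simp only [Complex.sub_re, Complex.add_re, Complex.smul_re, smul_eq_mul]
  ring

lemma sqrt_two_mul_two_mul_sq {x : ℝ} (hx : 0 ≤ x) : Real.sqrt (2 * (2 * x ^ 2)) = 2 * x := by
  rw [show 2 * (2 * x ^ 2) = (2 * x) ^ 2 by ring, Real.sqrt_sq (by positivity)]

end Entropies

theorem mainTheorem3 (n : ℕ) :
    -- positive definite matrices
    (∀ ρ₀ ∈ posDefs n, ∀ ρ₁ ∈ posDefs n,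
      ENNReal.ofReal (Real.sqrt (2 * quasiEntropy gZero ρ₀ ρ₁))
          = geodesicDist (wyMetric n) (posDefs n) ρ₀ ρ₁ ∧
      geodesicDist (wyMetric n) (posDefs n) ρ₀ ρ₁
          = ENNReal.ofReal (2 * ‖msqrt ρ₀ - msqrt ρ₁‖) ∧
      IsGeodesicPath (wyMetric n) (posDefs n) ρ₀ ρ₁ (fun t => sqrtSegment ρ₀ ρ₁ t ^ 2) ∧
      ∀ α ∈ Icc (-3 : ℝ) 3,
        geodesicDist (wyMetric n) (posDefs n) ρ₀ ρ₁
            ≤ geodesicDist (wydMetric n α) (posDefs n) ρ₀ ρ₁ ∧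
        geodesicDist (wydMetric n α) (posDefs n) ρ₀ ρ₁
            ≤ ENNReal.ofReal (Real.sqrt (2 * genEntropy gZero ρ₀ ρ₁))) ∧
    -- density matrices
    (∀ ρ₀ ∈ densities n, ∀ ρ₁ ∈ densities n,
      geodesicDist (wyMetric n) (densities n) ρ₀ ρ₁
          = ENNReal.ofReal (2 * Real.arccos (msqrt ρ₀ * msqrt ρ₁).trace.re) ∧
      IsGeodesicPath (wyMetric n) (densities n) ρ₀ ρ₁
        (fun t => (‖sqrtSegment ρ₀ ρ₁ t‖ ^ 2)⁻¹ • sqrtSegment ρ₀ ρ₁ t ^ 2) ∧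
      ∀ α ∈ Icc (-3 : ℝ) 3,
        ENNReal.ofReal (2 * Real.arccos (msqrt ρ₀ * msqrt ρ₁).trace.re)
            ≤ geodesicDist (wydMetric n α) (densities n) ρ₀ ρ₁ ∧
        geodesicDist (wydMetric n α) (densities n) ρ₀ ρ₁
            ≤ ENNReal.ofReal (2 * Real.arccos (geomMean ρ₀ ρ₁).trace.re)) := by
  -- The comparison is in terms of `α²`, so `α ∈ [-3,3]` lies between the extremes `0` and `3`.
  have hlow : ∀ α : ℝ, (0 : ℝ) ^ 2 ≤ α ^ 2 := fun α => by
    rw [zero_pow two_ne_zero]; exact sq_nonneg α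
  have hhigh : ∀ α ∈ Icc (-3 : ℝ) 3, α ^ 2 ≤ 3 ^ 2 := fun α hα => sq_le_sq' hα.1 hα.2
  have hsub : densities n ⊆ posDefs n := fun _ h => h.1
  refine ⟨fun ρ₀ h₀ ρ₁ h₁ => ?_, fun ρ₀ h₀ ρ₁ h₁ => ?_⟩
  · have hgeo := isGeodesicPath_sqrtSegment_sq h₀ h₁
    have hdist : geodesicDist (wyMetric n) (posDefs n) ρ₀ ρ₁ =
        ENNReal.ofReal (2 * ‖msqrt ρ₀ - msqrt ρ₁‖) :=
      (geodesicDist_eq_of_isGeodesicPath hgeo).trans (curveLength_sqrtSegment_sq h₀ h₁)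
    refine ⟨?_, hdist, hgeo, fun α hα => ⟨geodesicDist_wydMetric_mono subset_rfl (hlow α) _ _, ?_⟩⟩
    · rw [hdist, quasiEntropy_gZero h₀ h₁, sqrt_two_mul_two_mul_sq (norm_nonneg _)]
    · rw [genEntropy_gZero h₀ h₁, sqrt_two_mul_two_mul_sq (norm_nonneg _)]
      exact (geodesicDist_wydMetric_mono subset_rfl (hhigh α hα) _ _).trans
        (geodesicDist_wydMetric_three_le h₀ h₁)
  · have hgeo := isGeodesicPath_normalized_sqrtSegment_sq h₀ h₁
    have hdist : geodesicDist (wyMetric n) (densities n) ρ₀ ρ₁ =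
        ENNReal.ofReal (2 * Real.arccos (msqrt ρ₀ * msqrt ρ₁).trace.re) :=
      (geodesicDist_eq_of_isGeodesicPath hgeo).trans (curveLength_normalized_sqrtSegment_sq h₀ h₁)
    refine ⟨hdist, hgeo, fun α hα => ⟨?_, ?_⟩⟩
    · rw [← hdist]
      exact geodesicDist_wydMetric_mono hsub (hlow α) _ _
    · exact (geodesicDist_wydMetric_mono hsub (hhigh α hα) _ _).trans
        (geodesicDist_densities_wydMetric_three_le h₀ h₁)
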